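/- Let $H_B,H_E,\varsigma_B,\varsigma_E,\sigma_B,\sigma_E,A>0$, $\xi\in(0,1]$, $P\in(0,A]$, and suppose $\alpha:=\xi P/A<1$. For $k\in\{B,E\}$ let $$Y_k=H_kX+\sqrt{H_kX}\,Z_{k,1}+Z_{k,0},$$ where $Z_{k,1}\sim\mathcal N(0,\varsigma_k^2\sigma_k^2)$, $Z_{k,0}\sim\mathcal N(0,\sigma_k^2)$, and $X,Z_{k,1},Z_{k,0}$ are independent. Let the secrecy capacity under the non-negativity, peak-intensity and average-intensity constraints be $$C_s=\sup_{f_X}\,[\,I(X;Y_B)-I(X;Y_E)\,],$$ where $I$ is mutual information in nats and the supremum is over all probability density functions $f_X$ of $X$ with $0\le X\le A$ almost surely and $E[X]=\xi P$. Write $$f_{\rm low}=\tfrac12\ln\Big(H_B^2+\frac{2H_B\varsigma_B^2\sigma_B^2}{\xi P}\Big)-\frac{H_B\xi P+\varsigma_B^2\sigma_B^2}{\varsigma_B^2\sigma_B^2}+\frac{\sqrt{H_B\xi P(H_B\xi P+2\varsigma_B^2\sigma_B^2)}}{\varsigma_B^2\sigma_B^2},\qquad Ei(x)=\mathrm{p.v.}\int_{-\infty}^x\frac{e^t}{t}\,dt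 .$$ 1. If $\alpha=\tfrac12$, then $C_s\ge C_1$, where $$C_1=f_{\rm low}+\tfrac12\ln\frac{6A^2\sigma_E^2}{\pi e\sigma_B^2\,(H_E^2A^2+6AH_E\varsigma_E^2\sigma_E^2+12\sigma_E^2)}+\tfrac12\ln\frac{1+H_E\varsigma_E^2A}{1+H_B\varsigma_B^2A}-\frac{\ln(1+H_B\varsigma_B^2A)}{2AH_B\varsigma_B^2}+\frac{\ln(1+H_E\varsigma_E^2A)}{2AH_E\varsigma_E^2}.$$ 2. If $\alpha\ne\tfrac12$, then the equation $$\alpha=\frac1{1-e^{-cA}}-\frac1{cA}$$ has exactly one solution $c\in\mathbb R\setminus\{0\}$, and for this $c$ one has $C_s\ge C_2$, where $$\begin{aligned}C_2={}&f_{\rm low}-c\,\xi P+\tfrac12\ln\Big(\frac{\sigma_E^2}{\sigma_B^2}\frac{(e^{cA}-1)^2}{c^2}\Big)\\&+\frac1{2(e^{cA}-1)}\Big\{e^{cA}\ln\frac{1+H_E\varsigma_E^2A}{1+H_B\varsigma_B^2A}-e^{-c/(H_E\varsigma_E^2)}\Big[Ei\Big(\tfrac{c\,(1+H_E\varsigma_E^2A)}{H_E\varsigma_E^2}\Big)-Ei\Big(\tfrac{c}{H_E\varsigma_E^2}\Big)\Big]\\&\qquad+e^{-c/(H_B\varsigma_B^2)}\Big[Ei\Big(\tfrac{c\,(1+H_B\varsigma_B^2A)}{H_B\varsigma_B^2}\Big)-Ei\Big(\tfrac{c}{H_B\varsigma_B^2}\Big)\Big]\Big\}\\&-\tfrac12\ln\Big[2\pi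 e\Big(H_E^2\Big(\frac{A(cA-2)}{c(1-e^{-cA})}+\frac2{c^2}-\xi^2P^2\Big)+H_E\,\xi P\,\varsigma_E^2\sigma_E^2+\sigma_E^2\Big)\Big].\end{aligned}$$ -/

import Mathlib

open MeasureTheory ProbabilityTheory

noncomputable section

namespace VLC

/-- The exponential integral `Ei x = ∫_{-∞}^x e^t / t dt`, a Cauchy principal value at `t = 0`
when `x > 0` (for `x < 0` the cut-out interval is eventually disjoint from `(-∞, x]`). -/
def Ei (x : ℝ) : ℝ :=
  Filter.limUnder (nhdsWithin (0 : ℝ) (Set.Ioi 0))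
    (fun ε : ℝ => ∫ t in Set.Iic x \ Set.Ioo (-ε) ε, Real.exp t / t)

/-- The joint law of `(X, Y)`, where `X` has law `μ` and `Y = H X + √(H X) Z₁ + Z₀`, with
`Z₁ ∼ N(0, ς² σ²)` and `Z₀ ∼ N(0, σ²)`, and `X`, `Z₁`, `Z₀` are independent. -/
def jointLaw (H ς σ : ℝ) (μ : Measure ℝ) : Measure (ℝ × ℝ) :=
  (μ.prod ((gaussianReal 0 (Real.toNNReal (ς ^ 2 * σ ^ 2))).prod
      (gaussianReal 0 (Real.toNNReal (σ ^ 2))))).map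
    (fun p : ℝ × ℝ × ℝ => (p.1, H * p.1 + Real.sqrt (H * p.1) * p.2.1 + p.2.2))

/-- The mutual information, in nats, of a pair of real random variables with joint law `ρ`:
the relative entropy of the joint law with respect to the product of its marginals. -/
def mutualInfo (ρ : Measure (ℝ × ℝ)) : ENNReal :=
  InformationTheory.klDiv ρ (ρ.fst.prod ρ.snd)

/-- `μ` is the law of an input that has a probability density function, takes its values
in `[0, A]` and has mean `m`. -/
structure IsAdmissibleInput (A m : ℝ) (μ : Measure ℝ) : Prop where
  isProbabilityMeasure : IsProbabilityMeasure μ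
  absolutelyContinuous : μ ≪ volume
  mem_Icc : ∀ᵐ x ∂μ, x ∈ Set.Icc 0 A
  mean_eq : ∫ x, x ∂μ = m

/-- The secrecy capacity: the supremum of `I(X; Y_B) - I(X; Y_E)` over all admissible inputs. -/
def secrecyCapacity (HB ςB σB HE ςE σE A m : ℝ) : EReal :=
  ⨆ (μ : Measure ℝ) (_ : IsAdmissibleInput A m μ),
    ((mutualInfo (jointLaw HB ςB σB μ) : ENNReal) : EReal)
      - ((mutualInfo (jointLaw HE ςE σE μ) : ENNReal) : EReal)

/-- The gap between the output entropy and the input entropy at the legitimate receiver. -/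
def fLow (HB ςB σB ξ P : ℝ) : ℝ :=
  1 / 2 * Real.log (HB ^ 2 + 2 * HB * ςB ^ 2 * σB ^ 2 / (ξ * P))
    - (HB * ξ * P + ςB ^ 2 * σB ^ 2) / (ςB ^ 2 * σB ^ 2)
    + Real.sqrt (HB * ξ * P * (HB * ξ * P + 2 * ςB ^ 2 * σB ^ 2)) / (ςB ^ 2 * σB ^ 2)

/-- The lower bound for average-to-peak ratio `1 / 2`. -/
def C₁ (HB ςB σB HE ςE σE A ξ P : ℝ) : ℝ :=
  fLow HB ςB σB ξ P
    + 1 / 2 * Real.log (6 * A ^ 2 * σE ^ 2 /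
        (Real.pi * Real.exp 1 * σB ^ 2 *
          (HE ^ 2 * A ^ 2 + 6 * A * HE * ςE ^ 2 * σE ^ 2 + 12 * σE ^ 2)))
    + 1 / 2 * Real.log ((1 + HE * ςE ^ 2 * A) / (1 + HB * ςB ^ 2 * A))
    - Real.log (1 + HB * ςB ^ 2 * A) / (2 * A * HB * ςB ^ 2)
    + Real.log (1 + HE * ςE ^ 2 * A) / (2 * A * HE * ςE ^ 2)

/-- The lower bound for average-to-peak ratio different from `1 / 2`. -/
def C₂ (HB ςB σB HE ςE σE A ξ P c : ℝ) : ℝ :=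
  fLow HB ςB σB ξ P
    - c * ξ * P
    + 1 / 2 * Real.log (σE ^ 2 / σB ^ 2 * ((Real.exp (c * A) - 1) ^ 2 / c ^ 2))
    + 1 / (2 * (Real.exp (c * A) - 1)) *
        (Real.log ((1 + HE * ςE ^ 2 * A) / (1 + HB * ςB ^ 2 * A)) * Real.exp (c * A)
          - Real.exp (-(c / (HE * ςE ^ 2))) *
              (Ei (c / (HE * ςE ^ 2) * (1 + HE * ςE ^ 2 * A)) - Ei (c / (HE * ςE ^ 2)))
          + Real.exp (-(c / (HB * ςB ^ 2))) *
              (Ei (c / (HB * ςB ^ 2) * (1 + HB * ςB ^ 2 * A)) - Ei (c / (HB * ςB ^ 2))))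
    - 1 / 2 * Real.log (2 * Real.pi * Real.exp 1 *
        (HE ^ 2 * (A * (c * A - 2) / (c * (1 - Real.exp (-(c * A)))) + 2 / c ^ 2
            - ξ ^ 2 * P ^ 2)
          + HE * ξ * P * ςE ^ 2 * σE ^ 2 + σE ^ 2))

/-- `c` solves `α = 1 / (1 - e^{-cA}) - 1 / (cA)`; the equation makes sense only for `c ≠ 0`. -/
def IsRateParameter (α A c : ℝ) : Prop :=
  c ≠ 0 ∧ α = 1 / (1 - Real.exp (-(c * A))) - 1 / (c * A)

end VLC

end

open scoped ENNReal NNReal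

namespace VLC

/-! ### Transition density, output density and log-likelihood ratio of the channel. -/

section

/-! The capacity is a supremum, so one good input suffices. The input is the law on `(0, A]` with
density `exp (c x + d)`: uniform when `α = 1/2`, truncated exponential otherwise, with `c` fixed by
the mean and `d` by normalisation. Its entropy is `-(c ξ P + d)`. The mutual information of each
receiver is output entropy minus conditional entropy (`mutualInfo_channelLaw`), and the conditional
entropy is an explicit integral of `log (1 + H ς² x)`. It remains to bound the eavesdropper's output
entropy from above and the legitimate receiver's from below.

The upper bound is Gaussian maximality (`neg_integral_log_outDens_le`).

The lower bound (`integral_log_outDens_le`) says that the output entropy exceeds the input entropy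
by at least `fLow`. Let `Y'` be the output before the signal-independent noise, `a = ς² σ²`, `m = ξ
P` and `k² = H² + 2 H a / m`. By Jensen it is enough that the output density at `Y`, times `k exp
(-X/m - (H - k) Y' / (H a))` and divided by the input density at `X`, has expectation at most 1.
Completing the square turns `exp (-x/m)` times the Gaussian law of `Y'` into an exponential in `y`
times the law at time `x` of a Brownian motion with drift `k` and variance rate `H a`
(`tilted_transition_eq`). The integral of that law over time is at most `1/k` at every point
(`lintegral_drift_le`), which cancels the factor `k`. This is data processing against an exponential
reference input of mean `m`.

The rest is calculus. The mean of the truncated exponential, as a function of `u = c A`, is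
increasing on `u > 0` and symmetric about `1/2`, so `c` exists and is unique; integration by parts
against `Ei` evaluates the logarithmic integrals. -/

/-- The variance of the output given the input `x`, for signal-dependent noise of variance
`x ↦ H x a` and signal-independent noise of variance `b`. -/
noncomputable def outVar (H : ℝ) (a b : ℝ≥0) (x : ℝ) : ℝ≥0 :=
  NNReal.mk (Real.sqrt (H * x) ^ 2) (sq_nonneg _) * a + b

/-- The joint law of input and output, for noise variances `a` and `b`. -/
noncomputable def channelLaw (H : ℝ) (a b : ℝ≥0) (μ : Measure ℝ) : Measure (ℝ × ℝ) :=
  (μ.prod ((gaussianReal 0 a).prod (gaussianReal 0 b))).map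
    (fun p : ℝ × ℝ × ℝ => (p.1, H * p.1 + Real.sqrt (H * p.1) * p.2.1 + p.2.2))

/-- The density of the output law. -/
noncomputable def outDens (H : ℝ) (a b : ℝ≥0) (μ : Measure ℝ) (y : ℝ) : ℝ≥0∞ :=
  ∫⁻ x, gaussianPDF (H * x) (outVar H a b x) y ∂μ

variable {H : ℝ} {a b : ℝ≥0} {μ : Measure ℝ}

lemma outVar_coe (H : ℝ) (a b : ℝ≥0) (x : ℝ) :
    (outVar H a b x : ℝ) = Real.sqrt (H * x) ^ 2 * a + b := by
  simp [outVar, NNReal.coe_add, NNReal.coe_mul]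

lemma outVar_coe_of_nonneg {x : ℝ} (h : 0 ≤ H * x) :
    (outVar H a b x : ℝ) = H * x * a + b := by
  rw [outVar_coe, Real.sq_sqrt h]

lemma outVar_ne_zero (hb : b ≠ 0) (x : ℝ) : outVar H a b x ≠ 0 := by
  have : 0 < b := pos_iff_ne_zero.2 hb
  exact (add_pos_of_nonneg_of_pos (by positivity) this).ne'

@[fun_prop]
lemma measurable_outVar (H : ℝ) (a b : ℝ≥0) : Measurable (outVar H a b) := by
  have : Measurable fun x => NNReal.mk (Real.sqrt (H * x) ^ 2) (sq_nonneg _) :=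
    Measurable.subtype_mk (by fun_prop)
  exact (this.mul_const a).add_const b

@[fun_prop]
lemma measurable_channelMap (H : ℝ) : Measurable
    (fun p : ℝ × ℝ × ℝ => (p.1, H * p.1 + Real.sqrt (H * p.1) * p.2.1 + p.2.2)) := by
  fun_prop

lemma measurable_transition (H : ℝ) (a b : ℝ≥0) :
    Measurable fun p : ℝ × ℝ => gaussianPDF (H * p.1) (outVar H a b p.1) p.2 := by
  have : Measurable fun p : ℝ × ℝ => (H * p.1, outVar H a b p.1, p.2) := by fun_prop
  exact measurable_uncurry_gaussianPDF.comp this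

lemma measurable_transitionReal (H : ℝ) (a b : ℝ≥0) :
    Measurable fun p : ℝ × ℝ => gaussianPDFReal (H * p.1) (outVar H a b p.1) p.2 := by
  have : Measurable fun p : ℝ × ℝ => (H * p.1, outVar H a b p.1, p.2) := by fun_prop
  exact measurable_uncurry_gaussianPDFReal.comp this

lemma measurable_outDens [SFinite μ] : Measurable (outDens H a b μ) :=
  (measurable_transition H a b).lintegral_prod_left'

/-- Given the input `x`, the output without its signal-independent noise is Gaussian. -/
lemma map_signalNoise (H : ℝ) (a : ℝ≥0) (x : ℝ) :
    (gaussianReal 0 a).map (fun z => H * x + Real.sqrt (H * x) * z) =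
      gaussianReal (H * x) (outVar H a 0 x) := by
  have h1 := gaussianReal_map_const_mul (μ := 0) (v := a) (Real.sqrt (H * x))
  have h2 := gaussianReal_map_const_add (μ := 0)
    (v := NNReal.mk (Real.sqrt (H * x) ^ 2) (sq_nonneg _) * a) (H * x)
  rw [mul_zero] at h1
  rw [← h1, Measure.map_map (by fun_prop) (by fun_prop)] at h2
  simpa [Function.comp_def, outVar] using h2

/-- Given the input `x`, the output is Gaussian. -/
lemma map_noise (H : ℝ) (a b : ℝ≥0) (x : ℝ) :
    ((gaussianReal 0 a).prod (gaussianReal 0 b)).map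
      (fun q : ℝ × ℝ => H * x + Real.sqrt (H * x) * q.1 + q.2) =
    gaussianReal (H * x) (outVar H a b x) := by
  have h := gaussianReal_conv_gaussianReal (m₁ := H * x) (m₂ := 0)
    (v₁ := outVar H a 0 x) (v₂ := b)
  rw [← map_signalNoise, Measure.conv] at h
  -- With the second factor written as a pushforward by the identity, the product of two
  -- pushforwards becomes a single pushforward.
  nth_rewrite 1 [← Measure.map_id (μ := gaussianReal 0 b)] at h
  rw [Measure.map_prod_map _ _ (by fun_prop) (by fun_prop),
    Measure.map_map (by fun_prop) (by fun_prop)] at h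
  simpa [Function.comp_def, outVar] using h

lemma lintegral_channelLaw [SFinite μ] {g : ℝ × ℝ → ℝ≥0∞} (hg : Measurable g) :
    ∫⁻ p, g p ∂channelLaw H a b μ =
      ∫⁻ x, ∫⁻ y, g (x, y) ∂gaussianReal (H * x) (outVar H a b x) ∂μ := by
  rw [channelLaw, lintegral_map hg (by fun_prop), lintegral_prod _ (by fun_prop)]
  refine lintegral_congr fun x => ?_
  rw [← map_noise, lintegral_map (by fun_prop) (by fun_prop)]

lemma lintegral_channelLaw_eq_density [SFinite μ] (hb : b ≠ 0) {g : ℝ × ℝ → ℝ≥0∞}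
    (hg : Measurable g) :
    ∫⁻ p, g p ∂channelLaw H a b μ =
      ∫⁻ x, (∫⁻ y, gaussianPDF (H * x) (outVar H a b x) y * g (x, y)) ∂μ := by
  rw [lintegral_channelLaw hg]
  refine lintegral_congr fun x => ?_
  rw [gaussianReal_of_var_ne_zero _ (outVar_ne_zero hb x),
    lintegral_withDensity_eq_lintegral_mul _ (by fun_prop) (by fun_prop)]
  rfl

instance [IsProbabilityMeasure μ] : IsProbabilityMeasure (channelLaw H a b μ) :=
  Measure.isProbabilityMeasure_map (by fun_prop)

lemma channelLaw_fst [IsProbabilityMeasure μ] : (channelLaw H a b μ).fst = μ := by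
  rw [Measure.fst, channelLaw, Measure.map_map (by fun_prop) (by fun_prop)]
  exact Measure.fst_prod

lemma channelLaw_snd [SFinite μ] (hb : b ≠ 0) :
    (channelLaw H a b μ).snd = volume.withDensity (outDens H a b μ) := by
  ext s hs
  rw [Measure.snd_apply hs, withDensity_apply _ hs, ← lintegral_indicator_one (measurable_snd hs),
    lintegral_channelLaw_eq_density hb (measurable_one.indicator (measurable_snd hs)),
    lintegral_lintegral_swap, ← lintegral_indicator hs]
  · refine lintegral_congr fun y => ?_
    by_cases hy : y ∈ s <;> simp [hy, outDens, Set.indicator]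
  · exact ((measurable_transition H a b).mul
      (measurable_one.indicator (measurable_snd hs))).aemeasurable

lemma measurable_transition_left (H : ℝ) (a b : ℝ≥0) (y : ℝ) :
    Measurable fun x => gaussianPDF (H * x) (outVar H a b x) y := by
  have : Measurable fun x : ℝ => (H * x, outVar H a b x, y) := by fun_prop
  exact measurable_uncurry_gaussianPDF.comp this

lemma outDens_pos [NeZero μ] (hb : b ≠ 0) (y : ℝ) : 0 < outDens H a b μ y := by
  rw [outDens, pos_iff_ne_zero, ne_eq, lintegral_eq_zero_iff (measurable_transition_left H a b y)]
  intro h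
  refine NeZero.ne μ (ae_eq_bot.1 (Filter.eventually_false_iff_eq_bot.1 ?_))
  filter_upwards [h] with x hx
  exact (gaussianPDF_pos _ (outVar_ne_zero hb x) y).ne' hx

lemma gaussianPDFReal_le {m y : ℝ} {v : ℝ≥0} (hb : b ≠ 0) (hv : b ≤ v) :
    gaussianPDFReal m v y ≤ (Real.sqrt (2 * Real.pi * b))⁻¹ := by
  have hb' : (0 : ℝ) < b := by exact_mod_cast pos_iff_ne_zero.2 hb
  have hv' : (b : ℝ) ≤ v := by exact_mod_cast hv
  have hpi := Real.pi_pos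
  rw [gaussianPDFReal, ← mul_one (Real.sqrt (2 * Real.pi * b))⁻¹]
  refine mul_le_mul ?_ (Real.exp_le_one_iff.2 ?_) (Real.exp_nonneg _) (by positivity)
  · gcongr
  · exact div_nonpos_of_nonpos_of_nonneg (by nlinarith [sq_nonneg (y - m)]) (by positivity)

lemma le_outVar (x : ℝ) : b ≤ outVar H a b x := le_add_of_nonneg_left (by positivity)

lemma outDens_le [IsProbabilityMeasure μ] (hb : b ≠ 0) (y : ℝ) :
    outDens H a b μ y ≤ ENNReal.ofReal (Real.sqrt (2 * Real.pi * b))⁻¹ := by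
  calc outDens H a b μ y ≤ ∫⁻ _, ENNReal.ofReal (Real.sqrt (2 * Real.pi * b))⁻¹ ∂μ :=
        lintegral_mono fun x => ENNReal.ofReal_le_ofReal (gaussianPDFReal_le hb (le_outVar x))
    _ = _ := by simp

lemma outDens_ne_top [IsProbabilityMeasure μ] (hb : b ≠ 0) (y : ℝ) : outDens H a b μ y ≠ ∞ :=
  ((outDens_le hb y).trans_lt ENNReal.ofReal_lt_top).ne

lemma toReal_outDens_pos [IsProbabilityMeasure μ] (hb : b ≠ 0) (y : ℝ) :
    0 < (outDens H a b μ y).toReal :=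
  ENNReal.toReal_pos (outDens_pos hb y).ne' (outDens_ne_top hb y)

/-- The second marginal has density `outDens`, positive and finite everywhere, so it cancels against
the denominator. -/
lemma channelLaw_eq_withDensity [IsProbabilityMeasure μ] (hb : b ≠ 0) :
    channelLaw H a b μ =
      ((channelLaw H a b μ).fst.prod (channelLaw H a b μ).snd).withDensity
        (fun p => gaussianPDF (H * p.1) (outVar H a b p.1) p.2 / outDens H a b μ p.2) := by
  have hd : Measurable (fun p : ℝ × ℝ => gaussianPDF (H * p.1) (outVar H a b p.1) p.2 /
      outDens H a b μ p.2) :=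
    (measurable_transition H a b).div (measurable_outDens.comp measurable_snd)
  ext s hs
  have hs1 : Measurable (s.indicator (1 : ℝ × ℝ → ℝ≥0∞)) := measurable_one.indicator hs
  rw [withDensity_apply _ hs, ← lintegral_indicator hs, lintegral_prod _
    (hd.indicator hs).aemeasurable, channelLaw_fst, channelLaw_snd hb, ← lintegral_indicator_one hs,
    lintegral_channelLaw_eq_density hb hs1]
  refine lintegral_congr fun x => ?_
  have hx : Measurable fun y => s.indicator (fun p : ℝ × ℝ =>
      gaussianPDF (H * p.1) (outVar H a b p.1) p.2 / outDens H a b μ p.2) (x, y) :=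
    (hd.indicator hs).comp measurable_prodMk_left
  rw [lintegral_withDensity_eq_lintegral_mul _ measurable_outDens hx]
  refine lintegral_congr fun y => ?_
  by_cases h : (x, y) ∈ s
  · simp [h, ENNReal.mul_div_cancel (outDens_pos hb y).ne' (outDens_ne_top hb y)]
  · simp [h]

lemma channelLaw_absolutelyContinuous [IsProbabilityMeasure μ] (hb : b ≠ 0) :
    channelLaw H a b μ ≪ (channelLaw H a b μ).fst.prod (channelLaw H a b μ).snd := by
  conv_lhs => rw [channelLaw_eq_withDensity hb]
  exact withDensity_absolutelyContinuous _ _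

lemma llr_channelLaw [IsProbabilityMeasure μ] (hb : b ≠ 0) :
    llr (channelLaw H a b μ) ((channelLaw H a b μ).fst.prod (channelLaw H a b μ).snd)
      =ᵐ[channelLaw H a b μ]
    fun p => Real.log (gaussianPDFReal (H * p.1) (outVar H a b p.1) p.2)
      - Real.log (outDens H a b μ p.2).toReal := by
  have hd : Measurable (fun p : ℝ × ℝ => gaussianPDF (H * p.1) (outVar H a b p.1) p.2 /
      outDens H a b μ p.2) :=
    (measurable_transition H a b).div (measurable_outDens.comp measurable_snd)
  have h := Measure.rnDeriv_withDensity
    ((channelLaw H a b μ).fst.prod (channelLaw H a b μ).snd) hd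
  rw [← channelLaw_eq_withDensity hb] at h
  filter_upwards [(channelLaw_absolutelyContinuous hb).ae_le h] with p hp
  rw [llr, hp, ENNReal.toReal_div, toReal_gaussianPDF, Real.log_div
    (gaussianPDFReal_pos _ _ _ (outVar_ne_zero hb _)).ne' (toReal_outDens_pos hb _).ne']

end

/-! ### Integrability, conditional entropy, and the mutual information as a difference of entropies.
-/

section

variable {H A : ℝ} {a b : ℝ≥0} {μ : Measure ℝ}

lemma log_gaussianPDFReal (m : ℝ) {v : ℝ≥0} (hv : v ≠ 0) (y : ℝ) :
    Real.log (gaussianPDFReal m v y) =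
      -(1 / 2) * Real.log (2 * Real.pi * v) - (y - m) ^ 2 / (2 * v) := by
  have hv' : (0 : ℝ) < v := by exact_mod_cast pos_iff_ne_zero.2 hv
  have hpi := Real.pi_pos
  rw [gaussianPDFReal, Real.log_mul (by positivity) (Real.exp_ne_zero _), Real.log_exp,
    Real.log_inv, Real.log_sqrt (by positivity)]
  ring

lemma integral_sq_sub_gaussianReal (m c : ℝ) (v : ℝ≥0) :
    ∫ y, (y - c) ^ 2 ∂gaussianReal m v = v + (m - c) ^ 2 := by
  have h1 : Integrable (fun y : ℝ => y) (gaussianReal m v) :=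
    (memLp_id_gaussianReal 1).integrable le_rfl
  have h2 : Integrable (fun y : ℝ => (y - m) ^ 2) (gaussianReal m v) := by
    have := ((memLp_id_gaussianReal (μ := m) (v := v) 2).sub (memLp_const m)).integrable_sq
    simpa using this
  have hvar : ∫ y, (y - m) ^ 2 ∂gaussianReal m v = v := by
    have := variance_fun_id_gaussianReal (μ := m) (v := v)
    rw [variance_eq_integral (by fun_prop), integral_id_gaussianReal] at this
    exact this
  have h3 : Integrable (fun y : ℝ => 2 * (m - c) * (y - m)) (gaussianReal m v) :=
    (h1.sub (integrable_const m)).const_mul _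
  calc ∫ y, (y - c) ^ 2 ∂gaussianReal m v
      = ∫ y, ((y - m) ^ 2 + 2 * (m - c) * (y - m) + (m - c) ^ 2) ∂gaussianReal m v := by
        congr 1; ext y; ring
    _ = v + (m - c) ^ 2 := by
        rw [integral_add (by exact h2.add h3) (integrable_const _), integral_add h2 h3, hvar,
          integral_const_mul, integral_sub h1 (integrable_const m), integral_id_gaussianReal]
        simp

lemma integral_channelLaw [SFinite μ] {g : ℝ × ℝ → ℝ} (hg : Measurable g)
    (hi : Integrable g (channelLaw H a b μ)) :
    ∫ p, g p ∂channelLaw H a b μ =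
      ∫ x, ∫ y, g (x, y) ∂gaussianReal (H * x) (outVar H a b x) ∂μ := by
  rw [channelLaw] at hi ⊢
  rw [integral_map (by fun_prop) hg.aestronglyMeasurable, integral_prod]
  · refine integral_congr_ae (.of_forall fun x => ?_)
    dsimp only
    rw [← map_noise, integral_map (by fun_prop)]
    exact (hg.comp measurable_prodMk_left).aestronglyMeasurable
  · exact (integrable_map_measure hg.aestronglyMeasurable (by fun_prop)).1 hi

lemma integrable_sq_gaussianReal (m : ℝ) (v : ℝ≥0) :
    Integrable (fun y : ℝ => y ^ 2) (gaussianReal m v) := by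
  simpa using (memLp_id_gaussianReal (μ := m) (v := v) 2).integrable_sq

lemma integrable_sq_snd [IsProbabilityMeasure μ] (hH : 0 < H)
    (hμ : ∀ᵐ x ∂μ, x ∈ Set.Icc 0 A) :
    Integrable (fun p : ℝ × ℝ => p.2 ^ 2) (channelLaw H a b μ) := by
  rw [channelLaw, integrable_map_measure (by fun_prop) (by fun_prop)]
  have hb1 : Integrable (fun q : ℝ × ℝ => H * A * q.1 ^ 2 + q.2 ^ 2)
      ((gaussianReal 0 a).prod (gaussianReal 0 b)) :=
    (((integrable_sq_gaussianReal 0 a).const_mul (H * A)).comp_fst _).add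
      ((integrable_sq_gaussianReal 0 b).comp_snd _)
  -- The output is a sum of three terms, whence the factor 3 in `(u + v + w)² ≤ 3 (u² + v² + w²)`.
  have hb2 : Integrable (fun p : ℝ × ℝ × ℝ =>
      3 * (H ^ 2 * A ^ 2 + (H * A * p.2.1 ^ 2 + p.2.2 ^ 2)))
      (μ.prod ((gaussianReal 0 a).prod (gaussianReal 0 b))) :=
    ((integrable_const _).add (hb1.comp_snd μ)).const_mul 3
  refine hb2.mono' (by fun_prop) ?_
  have hfst : ∀ᵐ p ∂μ.prod ((gaussianReal 0 a).prod (gaussianReal 0 b)), p.1 ∈ Set.Icc 0 A :=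
    Measure.quasiMeasurePreserving_fst.ae hμ
  filter_upwards [hfst] with p hp
  obtain ⟨h0, h1⟩ := hp
  have hs : Real.sqrt (H * p.1) ^ 2 = H * p.1 := Real.sq_sqrt (by positivity)
  have hs2 : (Real.sqrt (H * p.1) * p.2.1) ^ 2 ≤ H * A * p.2.1 ^ 2 := by
    rw [mul_pow, hs]; gcongr
  have hx : (H * p.1) ^ 2 ≤ H ^ 2 * A ^ 2 := by rw [mul_pow]; gcongr
  simp only [Function.comp, Real.norm_eq_abs, abs_sq]
  nlinarith [sq_nonneg (H * p.1 - Real.sqrt (H * p.1) * p.2.1), sq_nonneg (H * p.1 - p.2.2),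
    sq_nonneg (Real.sqrt (H * p.1) * p.2.1 - p.2.2)]

lemma ae_fst_channelLaw [IsProbabilityMeasure μ] (hμ : ∀ᵐ x ∂μ, x ∈ Set.Icc 0 A) :
    ∀ᵐ p ∂channelLaw H a b μ, p.1 ∈ Set.Icc 0 A := by
  have : ∀ᵐ x ∂(channelLaw H a b μ).map Prod.fst, x ∈ Set.Icc 0 A := by
    rw [← Measure.fst, channelLaw_fst]; exact hμ
  exact ae_of_ae_map (by fun_prop) this

lemma integrable_sq_sub [IsProbabilityMeasure μ] (hH : 0 < H)
    (hμ : ∀ᵐ x ∂μ, x ∈ Set.Icc 0 A) :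
    Integrable (fun p : ℝ × ℝ => (p.2 - H * p.1) ^ 2) (channelLaw H a b μ) := by
  refine (((integrable_sq_snd hH hμ).const_mul 2).add
    (integrable_const (2 * (H ^ 2 * A ^ 2)))).mono' (by fun_prop) ?_
  filter_upwards [ae_fst_channelLaw hμ] with p hp
  obtain ⟨h0, h1⟩ := hp
  have hx : (H * p.1) ^ 2 ≤ H ^ 2 * A ^ 2 := by rw [mul_pow]; gcongr
  simp only [Real.norm_eq_abs, abs_sq, Pi.add_apply]
  nlinarith [sq_nonneg (p.2 + H * p.1)]

lemma outVar_le (hH : 0 < H) {x : ℝ} (hx : x ∈ Set.Icc 0 A) :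
    (outVar H a b x : ℝ) ≤ H * A * a + b := by
  rw [outVar_coe_of_nonneg (mul_nonneg hH.le hx.1)]
  have := hx.2
  gcongr

lemma coe_le_outVar (x : ℝ) : (b : ℝ) ≤ outVar H a b x := by exact_mod_cast le_outVar x

lemma abs_log_outVar_le (hH : 0 < H) (hb : b ≠ 0) {x : ℝ} (hx : x ∈ Set.Icc 0 A) :
    |Real.log (2 * Real.pi * outVar H a b x)| ≤
      |Real.log (2 * Real.pi * b)| + |Real.log (2 * Real.pi * (H * A * a + b))| := by
  have hb' : (0 : ℝ) < b := by exact_mod_cast pos_iff_ne_zero.2 hb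
  have hpi := Real.pi_pos
  have h1 := coe_le_outVar (H := H) (a := a) (b := b) x
  have h2 := outVar_le (a := a) (b := b) hH hx
  have h3 : Real.log (2 * Real.pi * b) ≤ Real.log (2 * Real.pi * outVar H a b x) := by
    gcongr
  have h4 : Real.log (2 * Real.pi * outVar H a b x) ≤
      Real.log (2 * Real.pi * (H * A * a + b)) := by
    have := hb'.trans_le h1
    gcongr
  rw [abs_le]
  constructor
  · linarith [neg_abs_le (Real.log (2 * Real.pi * b)),
      abs_nonneg (Real.log (2 * Real.pi * (H * A * a + b)))]
  · linarith [le_abs_self (Real.log (2 * Real.pi * (H * A * a + b))),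
      abs_nonneg (Real.log (2 * Real.pi * b))]

lemma integrable_log_outVar [IsProbabilityMeasure μ] (hH : 0 < H) (hb : b ≠ 0)
    (hμ : ∀ᵐ x ∂μ, x ∈ Set.Icc 0 A) :
    Integrable (fun x => Real.log (2 * Real.pi * outVar H a b x)) μ := by
  refine (integrable_const (|Real.log (2 * Real.pi * b)| +
    |Real.log (2 * Real.pi * (H * A * a + b))|)).mono'
      (Measurable.log (by fun_prop)).aestronglyMeasurable ?_
  filter_upwards [hμ] with x hx using abs_log_outVar_le hH hb hx

lemma integrable_log_transition [IsProbabilityMeasure μ] (hH : 0 < H) (hb : b ≠ 0)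
    (hμ : ∀ᵐ x ∂μ, x ∈ Set.Icc 0 A) :
    Integrable (fun p : ℝ × ℝ => Real.log (gaussianPDFReal (H * p.1) (outVar H a b p.1) p.2))
      (channelLaw H a b μ) := by
  have hb' : (0 : ℝ) < b := by exact_mod_cast pos_iff_ne_zero.2 hb
  refine ((integrable_const (|Real.log (2 * Real.pi * b)| +
    |Real.log (2 * Real.pi * (H * A * a + b))|)).add
    ((integrable_sq_sub hH hμ).div_const (2 * b))).mono'
      (measurable_transitionReal H a b).log.aestronglyMeasurable ?_
  filter_upwards [ae_fst_channelLaw hμ] with p hp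
  rw [log_gaussianPDFReal _ (outVar_ne_zero hb _)]
  have h1 := abs_log_outVar_le (a := a) hH hb hp
  have h2 : (p.2 - H * p.1) ^ 2 / (2 * (outVar H a b p.1)) ≤ (p.2 - H * p.1) ^ 2 / (2 * b) := by
    have := coe_le_outVar (H := H) (a := a) (b := b) p.1
    gcongr
  have h3 : 0 ≤ (p.2 - H * p.1) ^ 2 / (2 * (outVar H a b p.1)) := by positivity
  simp only [Real.norm_eq_abs, Pi.add_apply]
  rw [abs_le] at h1 ⊢
  constructor <;> linarith

lemma integral_log_transition [IsProbabilityMeasure μ] (hH : 0 < H) (hb : b ≠ 0)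
    (hμ : ∀ᵐ x ∂μ, x ∈ Set.Icc 0 A) :
    ∫ p, Real.log (gaussianPDFReal (H * p.1) (outVar H a b p.1) p.2) ∂channelLaw H a b μ =
      -(1 / 2) * (∫ x, Real.log (2 * Real.pi * outVar H a b x) ∂μ) - 1 / 2 := by
  rw [integral_channelLaw (measurable_transitionReal H a b).log
    (integrable_log_transition hH hb hμ)]
  have key : ∀ x, ∫ y, Real.log (gaussianPDFReal (H * x) (outVar H a b x) y)
      ∂gaussianReal (H * x) (outVar H a b x) =
      -(1 / 2) * Real.log (2 * Real.pi * outVar H a b x) - 1 / 2 := by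
    intro x
    have hv := outVar_ne_zero (H := H) (a := a) hb x
    have hv' : (outVar H a b x : ℝ) ≠ 0 := by exact_mod_cast hv
    simp_rw [log_gaussianPDFReal _ hv]
    rw [integral_sub (integrable_const _), integral_div, integral_sq_sub_gaussianReal]
    · simp; field_simp
    · have := ((memLp_id_gaussianReal (μ := H * x) (v := outVar H a b x) 2).sub
        (memLp_const (H * x))).integrable_sq
      exact Integrable.div_const (by simpa using this) _
  simp_rw [key]
  rw [integral_sub ((integrable_log_outVar hH hb hμ).const_mul _) (integrable_const _),
    integral_const_mul]
  simp

/-- Bounded inputs keep mean and variance in a compact range, so the mixture inherits a Gaussian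
lower bound. It makes the logarithm of the output density at most quadratic in `y`, hence
integrable. -/
lemma le_outDens [IsProbabilityMeasure μ] (hH : 0 < H) (hb : b ≠ 0)
    (hμ : ∀ᵐ x ∂μ, x ∈ Set.Icc 0 A) (y : ℝ) :
    ENNReal.ofReal ((Real.sqrt (2 * Real.pi * (H * A * a + b)))⁻¹ *
      Real.exp (-(y ^ 2 + H ^ 2 * A ^ 2) / b)) ≤ outDens H a b μ y := by
  have hb' : (0 : ℝ) < b := by exact_mod_cast pos_iff_ne_zero.2 hb
  have hpi := Real.pi_pos
  calc _ = ∫⁻ _, ENNReal.ofReal ((Real.sqrt (2 * Real.pi * (H * A * a + b)))⁻¹ *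
      Real.exp (-(y ^ 2 + H ^ 2 * A ^ 2) / b)) ∂μ := by simp
    _ ≤ _ := by
      refine lintegral_mono_ae ?_
      filter_upwards [hμ] with x hx
      refine ENNReal.ofReal_le_ofReal ?_
      have h1 := coe_le_outVar (H := H) (a := a) (b := b) x
      have h2 := outVar_le (a := a) (b := b) hH hx
      have h0 := hb'.trans_le h1
      have hx1 := hx.1
      have hx2 := hx.2
      have h3 : (H * x) ^ 2 ≤ H ^ 2 * A ^ 2 := by rw [mul_pow]; gcongr
      rw [gaussianPDFReal]
      refine mul_le_mul (by gcongr) (Real.exp_le_exp.2 ?_) (Real.exp_nonneg _) (by positivity)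
      rw [neg_div, neg_div, neg_le_neg_iff]
      calc (y - H * x) ^ 2 / (2 * (outVar H a b x)) ≤ (y - H * x) ^ 2 / (2 * b) := by gcongr
        _ ≤ (2 * (y ^ 2 + H ^ 2 * A ^ 2)) / (2 * b) := by
          gcongr
          nlinarith [sq_nonneg (y + H * x)]
        _ = _ := by field_simp

lemma integrable_log_outDens [IsProbabilityMeasure μ] (hH : 0 < H) (hA : 0 ≤ A) (hb : b ≠ 0)
    (hμ : ∀ᵐ x ∂μ, x ∈ Set.Icc 0 A) :
    Integrable (fun p : ℝ × ℝ => Real.log (outDens H a b μ p.2).toReal)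
      (channelLaw H a b μ) := by
  have hb' : (0 : ℝ) < b := by exact_mod_cast pos_iff_ne_zero.2 hb
  have hpi := Real.pi_pos
  set L := (Real.sqrt (2 * Real.pi * (H * A * a + b)))⁻¹ with hL
  set U := (Real.sqrt (2 * Real.pi * b))⁻¹ with hU
  have hLpos : 0 < L := by positivity
  refine ((((integrable_sq_snd hH hμ).add
    (integrable_const (H ^ 2 * A ^ 2))).div_const b).add
    (integrable_const (|Real.log L| + |Real.log U|))).mono'
      (measurable_outDens.comp measurable_snd).ennreal_toReal.log.aestronglyMeasurable
      (.of_forall fun p => ?_)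
  have hpos := toReal_outDens_pos (H := H) (a := a) (μ := μ) hb p.2
  have h1 : L * Real.exp (-(p.2 ^ 2 + H ^ 2 * A ^ 2) / b) ≤ (outDens H a b μ p.2).toReal :=
    (ENNReal.ofReal_le_iff_le_toReal (outDens_ne_top hb _)).1 (le_outDens hH hb hμ p.2)
  have h2 : (outDens H a b μ p.2).toReal ≤ U :=
    ENNReal.toReal_le_of_le_ofReal (by positivity) (outDens_le hb _)
  have h3 := Real.log_le_log (by positivity) h1
  have h4 := Real.log_le_log hpos h2
  rw [Real.log_mul hLpos.ne' (Real.exp_ne_zero _), Real.log_exp, neg_div] at h3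
  have h5 : 0 ≤ (p.2 ^ 2 + H ^ 2 * A ^ 2) / b := by positivity
  simp only [Real.norm_eq_abs, Pi.add_apply]
  rw [abs_le]
  constructor
  · linarith [neg_abs_le (Real.log L), abs_nonneg (Real.log U)]
  · linarith [le_abs_self (Real.log U), abs_nonneg (Real.log L)]

/-- The mutual information between input and output is the difference of the output entropy and the
conditional output entropy. -/
lemma mutualInfo_channelLaw [IsProbabilityMeasure μ] (hH : 0 < H) (hA : 0 ≤ A) (hb : b ≠ 0)
    (hμ : ∀ᵐ x ∂μ, x ∈ Set.Icc 0 A) :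
    ((mutualInfo (channelLaw H a b μ) : ENNReal) : EReal) =
      ((-(1 / 2) * (∫ x, Real.log (2 * Real.pi * outVar H a b x) ∂μ) - 1 / 2
        - ∫ p, Real.log (outDens H a b μ p.2).toReal ∂channelLaw H a b μ : ℝ) : EReal) := by
  have hi : Integrable (llr (channelLaw H a b μ)
      ((channelLaw H a b μ).fst.prod (channelLaw H a b μ).snd)) (channelLaw H a b μ) :=
    ((integrable_log_transition hH hb hμ).sub (integrable_log_outDens hH hA hb hμ)).congr
      (llr_channelLaw hb).symm
  have hac := channelLaw_absolutelyContinuous (H := H) (a := a) (μ := μ) hb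
  -- The divergence is finite because the log-likelihood ratio is integrable, so it may be computed
  -- as a real integral.
  rw [mutualInfo, ← EReal.coe_toReal (x := ((InformationTheory.klDiv (channelLaw H a b μ)
    ((channelLaw H a b μ).fst.prod (channelLaw H a b μ).snd) : ENNReal) : EReal))
    (by simpa using InformationTheory.klDiv_ne_top hac hi) (by simp), EReal.toReal_coe_ennreal,
    InformationTheory.toReal_klDiv_of_measure_eq hac (by simp),
    integral_congr_ae (llr_channelLaw hb),
    integral_sub (integrable_log_transition hH hb hμ) (integrable_log_outDens hH hA hb hμ),
    integral_log_transition hH hb hμ]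

/-- If `F` is positive with `∫ F ≤ 1`, then `∫ log F ≤ 0`. -/
lemma integral_log_nonpos {Ω : Type*} {mΩ : MeasurableSpace Ω} {ρ : Measure Ω}
    [IsProbabilityMeasure ρ] {F : Ω → ℝ} (hF : ∀ᵐ ω ∂ρ, 0 < F ω) (hm : AEStronglyMeasurable F ρ)
    (h1 : ∫⁻ ω, ENNReal.ofReal (F ω) ∂ρ ≤ 1) (hi : Integrable (fun ω => Real.log (F ω)) ρ) :
    ∫ ω, Real.log (F ω) ∂ρ ≤ 0 := by
  have hFi : Integrable F ρ := by
    refine ⟨hm, ?_⟩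
    rw [hasFiniteIntegral_iff_ofReal (hF.mono fun _ h => h.le)]
    exact h1.trans_lt ENNReal.one_lt_top
  have hF1 : ∫ ω, F ω ∂ρ ≤ 1 := by
    rw [integral_eq_lintegral_of_nonneg_ae (hF.mono fun _ h => h.le) hm]
    exact ENNReal.toReal_le_of_le_ofReal zero_le_one (by simpa using h1)
  calc ∫ ω, Real.log (F ω) ∂ρ ≤ ∫ ω, (F ω - 1) ∂ρ := by
        refine integral_mono_ae hi (hFi.sub (integrable_const 1)) ?_
        filter_upwards [hF] with ω h using Real.log_le_sub_one_of_pos h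
    _ = ∫ ω, F ω ∂ρ - 1 := by rw [integral_sub hFi (integrable_const 1)]; simp
    _ ≤ 0 := by linarith

end

/-! ### Upper bound on the output entropy by Gaussian maximality. -/

section

variable {H A : ℝ} {a b : ℝ≥0} {μ : Measure ℝ}

lemma integral_sq_snd_sub [IsProbabilityMeasure μ] (hH : 0 < H)
    (hμ : ∀ᵐ x ∂μ, x ∈ Set.Icc 0 A) (c : ℝ) :
    Integrable (fun p : ℝ × ℝ => (p.2 - c) ^ 2) (channelLaw H a b μ) ∧
    ∫ p, (p.2 - c) ^ 2 ∂channelLaw H a b μ = ∫ x, (outVar H a b x + (H * x - c) ^ 2) ∂μ := by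
  have hi : Integrable (fun p : ℝ × ℝ => (p.2 - c) ^ 2) (channelLaw H a b μ) := by
    refine (((integrable_sq_snd hH hμ).const_mul 2).add (integrable_const (2 * c ^ 2))).mono'
      (by fun_prop) (.of_forall fun p => ?_)
    simp only [Real.norm_eq_abs, abs_sq, Pi.add_apply]
    nlinarith [sq_nonneg (p.2 + c)]
  refine ⟨hi, ?_⟩
  rw [integral_channelLaw (by fun_prop) hi]
  simp_rw [integral_sq_sub_gaussianReal]

/-- The Gaussian law maximises the entropy under a second moment constraint. -/
lemma neg_integral_log_outDens_le [IsProbabilityMeasure μ] (hH : 0 < H) (hA : 0 ≤ A) (hb : b ≠ 0)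
    (hμ : ∀ᵐ x ∂μ, x ∈ Set.Icc 0 A) (c : ℝ) {V : ℝ} (hV : 0 < V)
    (hVc : ∫ x, (outVar H a b x + (H * x - c) ^ 2) ∂μ = V) :
    -∫ p, Real.log (outDens H a b μ p.2).toReal ∂channelLaw H a b μ ≤
      1 / 2 * Real.log (2 * Real.pi * V) + 1 / 2 := by
  lift V to ℝ≥0 using hV.le
  have hV0 : V ≠ 0 := by rintro rfl; simp at hV
  obtain ⟨hi, hs⟩ := integral_sq_snd_sub (a := a) (b := b) hH hμ c
  rw [hVc] at hs
  have hlog : ∀ p : ℝ × ℝ, Real.log (gaussianPDFReal c V p.2 / (outDens H a b μ p.2).toReal) =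
      (-(1 / 2) * Real.log (2 * Real.pi * V) - (p.2 - c) ^ 2 / (2 * V)) -
        Real.log (outDens H a b μ p.2).toReal := fun p => by
    rw [Real.log_div (gaussianPDFReal_pos _ _ _ hV0).ne' (toReal_outDens_pos hb _).ne',
      log_gaussianPDFReal _ hV0]
  have hi1 : Integrable (fun p : ℝ × ℝ => -(1 / 2) * Real.log (2 * Real.pi * V) -
      (p.2 - c) ^ 2 / (2 * V)) (channelLaw H a b μ) :=
    (integrable_const _).sub (hi.div_const _)
  have hi2 := integrable_log_outDens (a := a) hH hA hb hμ
  have hm : Measurable fun y => gaussianPDFReal c V y / (outDens H a b μ y).toReal :=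
    (measurable_gaussianPDFReal c V).div measurable_outDens.ennreal_toReal
  -- Gibbs' inequality: the ratio of the Gaussian density to the output density has expectation 1
  -- under the output law.
  have h := integral_log_nonpos (ρ := channelLaw H a b μ)
    (F := fun p => gaussianPDFReal c V p.2 / (outDens H a b μ p.2).toReal)
    (.of_forall fun p => div_pos (gaussianPDFReal_pos _ _ _ hV0) (toReal_outDens_pos hb _))
    (hm.comp measurable_snd).aestronglyMeasurable ?_ ?_
  · simp_rw [hlog] at h
    rw [integral_sub hi1 hi2, integral_sub (integrable_const _) (hi.div_const _), integral_div,
      hs] at h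
    have : (V : ℝ) / (2 * V) = 1 / 2 := by field_simp
    rw [this] at h
    simp only [integral_const, probReal_univ, one_smul] at h
    linarith
  · have hm' : Measurable fun y =>
        ENNReal.ofReal (gaussianPDFReal c V y / (outDens H a b μ y).toReal) := hm.ennreal_ofReal
    have h1 : ∫⁻ p, ENNReal.ofReal (gaussianPDFReal c V p.2 / (outDens H a b μ p.2).toReal)
        ∂channelLaw H a b μ = ∫⁻ y, ENNReal.ofReal (gaussianPDFReal c V y /
          (outDens H a b μ y).toReal) ∂(channelLaw H a b μ).snd := by
      rw [Measure.snd, lintegral_map hm' measurable_snd]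
    rw [h1, channelLaw_snd hb, lintegral_withDensity_eq_lintegral_mul _ measurable_outDens hm',
      ← lintegral_gaussianPDF_eq_one c hV0]
    refine le_of_eq (lintegral_congr fun y => ?_)
    rw [Pi.mul_apply, ENNReal.ofReal_div_of_pos (toReal_outDens_pos hb y),
      ENNReal.ofReal_toReal (outDens_ne_top hb y),
      ENNReal.mul_div_cancel (outDens_pos hb y).ne' (outDens_ne_top hb y)]
    rfl
  · simp_rw [hlog]
    exact hi1.sub hi2

/-! ### Occupation density of Brownian motion with positive drift. -/

/-- The unnormalised Gaussian distribution function. -/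
noncomputable def gaussCdf (t : ℝ) : ℝ := ∫ s in Set.Iic t, Real.exp (-(1 / 2) * s ^ 2)

lemma integrable_exp_half_sq : Integrable fun s : ℝ => Real.exp (-(1 / 2) * s ^ 2) :=
  integrable_exp_neg_mul_sq (by norm_num)

lemma gaussCdf_nonneg (t : ℝ) : 0 ≤ gaussCdf t :=
  integral_nonneg fun _ => Real.exp_nonneg _

lemma gaussCdf_le (t : ℝ) : gaussCdf t ≤ Real.sqrt (2 * Real.pi) := by
  calc gaussCdf t ≤ ∫ s, Real.exp (-(1 / 2) * s ^ 2) :=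
        setIntegral_le_integral integrable_exp_half_sq (.of_forall fun _ => Real.exp_nonneg _)
    _ = Real.sqrt (2 * Real.pi) := by
        rw [integral_gaussian]; congr 1; field_simp

lemma hasDerivAt_gaussCdf (t : ℝ) : HasDerivAt gaussCdf (Real.exp (-(1 / 2) * t ^ 2)) t := by
  have h1 : gaussCdf = fun u => gaussCdf 0 + ∫ s in (0 : ℝ)..u, Real.exp (-(1 / 2) * s ^ 2) := by
    ext u
    rw [intervalIntegral.integral_Iic_sub_Iic integrable_exp_half_sq.integrableOn
      integrable_exp_half_sq.integrableOn |>.symm]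
    simp [gaussCdf]
  rw [h1]
  have hc : Continuous fun s : ℝ => Real.exp (-(1 / 2) * s ^ 2) := by fun_prop
  exact (hc.integral_hasStrictDerivAt 0 t).hasDerivAt.const_add _

/-- Shifting the variable by `2u` puts both integrals on `s ≤ u - v`; there the exponents differ by
`2u (s - (u - v)) ≤ 0`. -/
lemma exp_mul_gaussCdf_le {u : ℝ} (hu : 0 ≤ u) (v : ℝ) :
    Real.exp (2 * u * v) * gaussCdf (-(u + v)) ≤ gaussCdf (u - v) := by
  have h1 : gaussCdf (-(u + v)) =
      ∫ s in Set.Iic (u - v), Real.exp (-(1 / 2) * (s - 2 * u) ^ 2) := by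
    have hmp := measurePreserving_sub_right (volume : Measure ℝ) (2 * u)
    have hemb := (MeasurableEquiv.subRight (2 * u)).measurableEmbedding
    have := hmp.setIntegral_preimage_emb hemb (fun s => Real.exp (-(1 / 2) * s ^ 2))
      (Set.Iic (-(u + v)))
    rw [gaussCdf, ← this]
    congr 2
    ext s
    simp only [Set.mem_preimage, Set.mem_Iic]
    constructor <;> intro h <;> linarith
  have hi : Integrable fun s : ℝ => Real.exp (-(1 / 2) * (s - 2 * u) ^ 2) :=
    integrable_exp_half_sq.comp_sub_right (2 * u)
  rw [h1, gaussCdf, ← integral_const_mul]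
  refine setIntegral_mono_on (hi.const_mul _).integrableOn integrable_exp_half_sq.integrableOn
    measurableSet_Iic fun s hs => ?_
  rw [← Real.exp_add]
  refine Real.exp_le_exp.2 ?_
  have : 0 ≤ u * (u - v - s) := mul_nonneg hu (by simpa using hs)
  nlinarith

/-- The bounded antiderivative of the Green function of Brownian motion with drift. -/
noncomputable def driftPrimitive (k s y x : ℝ) : ℝ :=
  gaussCdf ((k * x - y) / Real.sqrt (s * x)) -
    Real.exp (2 * k * y / s) * gaussCdf (-(k * x + y) / Real.sqrt (s * x))

lemma driftPrimitive_le (k s y x : ℝ) : driftPrimitive k s y x ≤ Real.sqrt (2 * Real.pi) := by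
  have := gaussCdf_le ((k * x - y) / Real.sqrt (s * x))
  have := mul_nonneg (Real.exp_nonneg (2 * k * y / s))
    (gaussCdf_nonneg (-(k * x + y) / Real.sqrt (s * x)))
  rw [driftPrimitive]; linarith

lemma driftPrimitive_nonneg {k s x : ℝ} (hk : 0 < k) (hs : 0 < s) (hx : 0 < x) (y : ℝ) :
    0 ≤ driftPrimitive k s y x := by
  have hr : 0 < Real.sqrt (s * x) := Real.sqrt_pos.2 (by positivity)
  have hr2 : Real.sqrt (s * x) ^ 2 = s * x := Real.sq_sqrt (by positivity)
  have h := exp_mul_gaussCdf_le (u := k * x / Real.sqrt (s * x)) (by positivity)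
    (y / Real.sqrt (s * x))
  have e1 : 2 * (k * x / Real.sqrt (s * x)) * (y / Real.sqrt (s * x)) = 2 * k * y / s := by
    rw [mul_assoc, div_mul_div_comm, ← sq, hr2]; field_simp
  rw [e1, ← add_div, ← sub_div, ← neg_div] at h
  rw [driftPrimitive]; linarith

/-- The prefactor `exp (2 k y / s)` makes the two Gaussian factors from the chain rule equal. Only
the derivative of the difference of the arguments, `2 k x / √(s x)`, survives. -/
lemma hasDerivAt_driftPrimitive {k s x : ℝ} (hs : 0 < s) (hx : 0 < x) (y : ℝ) :
    HasDerivAt (driftPrimitive k s y)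
      (k * ((Real.sqrt (s * x))⁻¹ * Real.exp (-(y - k * x) ^ 2 / (2 * (s * x))))) x := by
  have hr : 0 < Real.sqrt (s * x) := Real.sqrt_pos.2 (by positivity)
  have hr2 : Real.sqrt (s * x) ^ 2 = s * x := Real.sq_sqrt (by positivity)
  have hd : HasDerivAt (fun x => Real.sqrt (s * x)) (s / (2 * Real.sqrt (s * x))) x := by
    have := ((hasDerivAt_id x).const_mul s).sqrt (by simpa using (by positivity : s * x ≠ 0))
    simpa using this
  have hn1 : HasDerivAt (fun x => k * x - y) k x := by
    simpa using ((hasDerivAt_id x).const_mul k).sub_const y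
  have hn2 : HasDerivAt (fun x => -(k * x + y)) (-k) x :=
    (((hasDerivAt_id' x).const_mul k).add_const y).fun_neg.congr_deriv (by simp)
  have h1 := (hasDerivAt_gaussCdf _).comp x (hn1.div hd hr.ne')
  have h2 := ((hasDerivAt_gaussCdf _).comp x (hn2.div hd hr.ne')).const_mul
    (Real.exp (2 * k * y / s))
  refine (h1.sub h2).congr_deriv ?_
  have e1 : Real.exp (-(1 / 2) * ((k * x - y) / Real.sqrt (s * x)) ^ 2) =
      Real.exp (-(y - k * x) ^ 2 / (2 * (s * x))) := by
    congr 1; rw [div_pow, hr2]; field_simp; ring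
  have e2 : Real.exp (2 * k * y / s) *
      Real.exp (-(1 / 2) * (-(k * x + y) / Real.sqrt (s * x)) ^ 2) =
      Real.exp (-(y - k * x) ^ 2 / (2 * (s * x))) := by
    rw [← Real.exp_add]; congr 1; rw [div_pow, hr2]; field_simp; ring
  simp only [Pi.div_apply]
  rw [← mul_assoc (Real.exp (2 * k * y / s)), e1, e2, ← mul_sub]
  have e3 : (k * Real.sqrt (s * x) - (k * x - y) * (s / (2 * Real.sqrt (s * x)))) /
      Real.sqrt (s * x) ^ 2 - (-k * Real.sqrt (s * x) - -(k * x + y) *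
        (s / (2 * Real.sqrt (s * x)))) / Real.sqrt (s * x) ^ 2 = k * (Real.sqrt (s * x))⁻¹ := by
    -- Eliminating `s` leaves a rational identity in `r = √(s x)` and `x`.
    have hsr : s = Real.sqrt (s * x) ^ 2 / x := by rw [hr2]; field_simp
    generalize Real.sqrt (s * x) = r at *
    subst hsr
    field_simp
    ring
  rw [e3]; ring

/-- The integrand is the derivative of `driftPrimitive` divided by `k √(2π)`, and `driftPrimitive`
stays in `[0, √(2π)]`. The singular endpoint 0 is reached by exhausting `(0, A]` with intervals
`(1/(n+1), A]`. -/
lemma lintegral_drift_le {k s : ℝ} (hk : 0 < k) (hs : 0 < s) (y A : ℝ) :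
    ∫⁻ x in Set.Ioc 0 A, ENNReal.ofReal ((Real.sqrt (2 * Real.pi * (s * x)))⁻¹ *
      Real.exp (-(y - k * x) ^ 2 / (2 * (s * x)))) ≤ ENNReal.ofReal k⁻¹ := by
  set f : ℝ → ℝ := fun x => (Real.sqrt (2 * Real.pi * (s * x)))⁻¹ *
      Real.exp (-(y - k * x) ^ 2 / (2 * (s * x))) with hf
  have hpi := Real.pi_pos
  have hderiv : ∀ x, 0 < x → HasDerivAt (fun x => (k * Real.sqrt (2 * Real.pi))⁻¹ *
      driftPrimitive k s y x) (f x) x := fun x hx => by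
    refine ((hasDerivAt_driftPrimitive (k := k) hs hx y).const_mul
      (k * Real.sqrt (2 * Real.pi))⁻¹).congr_deriv ?_
    rw [hf]
    simp only
    rw [Real.sqrt_mul (by positivity : 0 ≤ 2 * Real.pi) (s * x)]
    field_simp
  have hbound : ∀ ε, 0 < ε →
      ∫⁻ x in Set.Ioc ε A, ENNReal.ofReal (f x) ≤ ENNReal.ofReal k⁻¹ := fun ε hε => by
    rcases le_or_gt A ε with h | h
    · simp [Set.Ioc_eq_empty_of_le h]
    have hc : ContinuousOn f (Set.uIcc ε A) := by
      rw [Set.uIcc_of_le h.le]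
      have hx0 : ∀ x ∈ Set.Icc ε A, 0 < x := fun x hx => hε.trans_le hx.1
      refine ContinuousOn.mul (ContinuousOn.inv₀ (by fun_prop) fun x hx => ?_)
        (ContinuousOn.rexp (ContinuousOn.div (by fun_prop) (by fun_prop) fun x hx => ?_))
      · have := hx0 x hx; positivity
      · have := hx0 x hx; positivity
    have hi := hc.intervalIntegrable (μ := volume)
    have hI := intervalIntegral.integral_eq_sub_of_hasDerivAt (a := ε) (b := A)
      (fun x hx => hderiv x (hε.trans_le (by rw [Set.uIcc_of_le h.le] at hx; exact hx.1))) hi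
    rw [intervalIntegral.integral_of_le h.le] at hI
    rw [← ofReal_integral_eq_lintegral_ofReal
      ((intervalIntegrable_iff_integrableOn_Ioc_of_le h.le).1 hi)
      (.of_forall fun x => by positivity), hI]
    refine ENNReal.ofReal_le_ofReal ?_
    have h1 := driftPrimitive_le k s y A
    have h2 := driftPrimitive_nonneg hk hs hε y
    rw [← mul_sub, mul_inv, mul_assoc]
    have h3 : 0 < Real.sqrt (2 * Real.pi) := by positivity
    refine mul_le_of_le_one_right (by positivity) ?_
    rw [inv_mul_le_iff₀ h3]
    linarith
  have hU : Set.Ioc 0 A = ⋃ n : ℕ, Set.Ioc (1 / ((n : ℝ) + 1)) A := by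
    ext x
    simp only [Set.mem_iUnion, Set.mem_Ioc]
    constructor
    · rintro ⟨h0, h1⟩
      obtain ⟨n, hn⟩ := exists_nat_one_div_lt h0
      exact ⟨n, hn, h1⟩
    · rintro ⟨n, hn, h1⟩
      exact ⟨lt_trans (by positivity) hn, h1⟩
  have hmono : Monotone fun n : ℕ => Set.Ioc (1 / ((n : ℝ) + 1)) A := fun n m hnm => by
    refine Set.Ioc_subset_Ioc_left ?_
    exact one_div_le_one_div_of_le (by positivity) (by exact_mod_cast Nat.succ_le_succ hnm)
  have hmeas : ∀ S : Set ℝ, MeasurableSet S → ∫⁻ x in S, ENNReal.ofReal (f x) =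
      (volume.withDensity fun x => ENNReal.ofReal (f x)) S := fun S hS =>
    (withDensity_apply _ hS).symm
  rw [hmeas _ measurableSet_Ioc, hU, hmono.measure_iUnion]
  refine iSup_le fun n => ?_
  rw [← hmeas _ measurableSet_Ioc]
  exact hbound _ (by positivity)

end

/-! ### Lower bound on the output entropy for an exponential input density. -/

section

variable {H A : ℝ} {a b : ℝ≥0} {μ : Measure ℝ}

/-- The measure on `(0, A]` with density `x ↦ exp (c x + d)`. -/
noncomputable def expInput (A c d : ℝ) : Measure ℝ :=
  (volume.restrict (Set.Ioc 0 A)).withDensity fun x => ENNReal.ofReal (Real.exp (c * x + d))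

lemma ae_mem_expInput (A c d : ℝ) : ∀ᵐ x ∂expInput A c d, x ∈ Set.Ioc 0 A :=
  (withDensity_absolutelyContinuous _ _).ae_le (ae_restrict_mem measurableSet_Ioc)

lemma ae_mem_Icc_expInput (A c d : ℝ) : ∀ᵐ x ∂expInput A c d, x ∈ Set.Icc 0 A :=
  (ae_mem_expInput A c d).mono fun _ h => Set.Ioc_subset_Icc_self h

lemma lintegral_expInput (A c d : ℝ) {g : ℝ → ℝ≥0∞} (hg : Measurable g) :
    ∫⁻ x, g x ∂expInput A c d =
      ∫⁻ x in Set.Ioc 0 A, ENNReal.ofReal (Real.exp (c * x + d)) * g x := by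
  rw [expInput, lintegral_withDensity_eq_lintegral_mul _ (by fun_prop) hg]
  rfl

lemma lintegral_outDens [IsProbabilityMeasure μ] (hb : b ≠ 0) :
    ∫⁻ y, outDens H a b μ y = 1 := by
  have h := channelLaw_snd (H := H) (a := a) (μ := μ) hb
  rw [← setLIntegral_univ, ← withDensity_apply _ MeasurableSet.univ, ← h]
  exact measure_univ

/-- An exponential tilt in `y` changes the drift of a Gaussian kernel from `H` to `k` at the cost of
a factor exponential in `x`; `hk2` says precisely that this factor is `exp (-x/m)`. -/
lemma tilted_transition_eq {k m c d x y : ℝ} (hH : 0 < H) (ha : a ≠ 0) (hm : 0 < m) (hk : 0 < k)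
    (hk2 : k ^ 2 = H ^ 2 + 2 * H * a / m) (hx : 0 < x) :
    Real.exp (c * x + d) * (gaussianPDFReal (H * x) (outVar H a 0 x) y *
      Real.exp (-(x / m) - (c * x + d) + Real.log k - (H - k) / (H * a) * y)) =
    k * ((Real.sqrt (2 * Real.pi * (H * a * x)))⁻¹ *
      Real.exp (-(y - k * x) ^ 2 / (2 * (H * a * x)))) := by
  have ha' : (0 : ℝ) < a := by exact_mod_cast pos_iff_ne_zero.2 ha
  have hv : (outVar H a 0 x : ℝ) = H * a * x := by
    rw [outVar_coe_of_nonneg (by positivity)]; simp; ring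
  have he : -(x / m) - (H - k) / (H * a) * y + -(y - H * x) ^ 2 / (2 * (H * a * x)) =
      -(y - k * x) ^ 2 / (2 * (H * a * x)) := by
    have hm' : x / m = (k ^ 2 - H ^ 2) * x / (2 * H * a) := by
      rw [hk2]; field_simp; ring
    rw [hm']; field_simp; ring
  rw [gaussianPDFReal, hv, ← he]
  have e1 : Real.exp (-(x / m) - (c * x + d) + Real.log k - (H - k) / (H * a) * y) =
      k * (Real.exp (-(c * x + d)) * Real.exp (-(x / m) - (H - k) / (H * a) * y)) := by
    rw [← Real.exp_add]
    calc _ = Real.exp (Real.log k + (-(c * x + d) + (-(x / m) - (H - k) / (H * a) * y))) := by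
          congr 1; ring
      _ = _ := by rw [Real.exp_add, Real.exp_log hk]
  rw [e1, Real.exp_add (-(x / m) - (H - k) / (H * a) * y), Real.exp_neg]
  field_simp

lemma lintegral_noise [SFinite μ] {f : ℝ → ℝ≥0∞} (hf : Measurable f) {W : ℝ × ℝ → ℝ≥0∞}
    (hW : Measurable W) :
    ∫⁻ p : ℝ × ℝ × ℝ, f (H * p.1 + Real.sqrt (H * p.1) * p.2.1 + p.2.2) *
        W (p.1, H * p.1 + Real.sqrt (H * p.1) * p.2.1)
      ∂μ.prod ((gaussianReal 0 a).prod (gaussianReal 0 b)) =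
    ∫⁻ x, ∫⁻ y, (∫⁻ z, f (y + z) ∂gaussianReal 0 b) * W (x, y)
      ∂gaussianReal (H * x) (outVar H a 0 x) ∂μ := by
  rw [lintegral_prod _ (by fun_prop)]
  refine lintegral_congr fun x => ?_
  have hh : Measurable fun y => ∫⁻ z, f (y + z) ∂gaussianReal 0 b :=
    Measurable.lintegral_prod_right' (f := fun p : ℝ × ℝ => f (p.1 + p.2)) (by fun_prop)
  rw [lintegral_prod _ (by fun_prop), ← map_signalNoise, lintegral_map (by fun_prop)
    (by fun_prop)]
  refine lintegral_congr fun z => ?_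
  dsimp only
  rw [lintegral_mul_const _ (by fun_prop)]

/-- Without signal-independent noise the kernel degenerates at `x = 0`; this is why the input lives
on the half-open interval. -/
lemma outVar_zero_ne_zero (hH : 0 < H) (ha : a ≠ 0) {x : ℝ} (hx : 0 < x) :
    outVar H a 0 x ≠ 0 := by
  have ha' : (0 : ℝ) < a := by exact_mod_cast pos_iff_ne_zero.2 ha
  have : (0 : ℝ) < outVar H a 0 x := by
    rw [outVar_coe_of_nonneg (by positivity)]; simp; positivity
  exact_mod_cast this.ne'

lemma lintegral_expInput_gaussianReal (hH : 0 < H) (ha : a ≠ 0) (A c d : ℝ) {h : ℝ → ℝ≥0∞}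
    (hh : Measurable h) {W : ℝ × ℝ → ℝ≥0∞} (hW : Measurable W) :
    ∫⁻ x, ∫⁻ y, h y * W (x, y) ∂gaussianReal (H * x) (outVar H a 0 x) ∂expInput A c d =
    ∫⁻ y, h y * (∫⁻ x in Set.Ioc 0 A, ENNReal.ofReal (Real.exp (c * x + d)) *
      (gaussianPDF (H * x) (outVar H a 0 x) y * W (x, y))) := by
  have hGm : Measurable fun p : ℝ × ℝ => gaussianPDF (H * p.1) (outVar H a 0 p.1) p.2 *
      (h p.2 * W p) :=
    (measurable_transition H a 0).mul ((hh.comp measurable_snd).mul hW)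
  have hLm : Measurable fun p : ℝ × ℝ => ENNReal.ofReal (Real.exp (c * p.1 + d)) *
      (gaussianPDF (H * p.1) (outVar H a 0 p.1) p.2 * W p) :=
    Measurable.mul (by fun_prop) ((measurable_transition H a 0).mul hW)
  calc _ = ∫⁻ x, (∫⁻ y, gaussianPDF (H * x) (outVar H a 0 x) y * (h y * W (x, y)))
        ∂expInput A c d := by
        refine lintegral_congr_ae ?_
        filter_upwards [ae_mem_expInput A c d] with x hx
        rw [gaussianReal_of_var_ne_zero _ (outVar_zero_ne_zero hH ha hx.1),
          lintegral_withDensity_eq_lintegral_mul _ (by fun_prop) (by fun_prop)]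
        rfl
    _ = ∫⁻ x in Set.Ioc 0 A, (∫⁻ y, h y * (ENNReal.ofReal (Real.exp (c * x + d)) *
          (gaussianPDF (H * x) (outVar H a 0 x) y * W (x, y)))) := by
        rw [lintegral_expInput A c d (by exact hGm.lintegral_prod_right')]
        refine lintegral_congr fun x => ?_
        have hGx : Measurable fun y => gaussianPDF (H * x) (outVar H a 0 x) y *
            (h y * W (x, y)) :=
          (measurable_gaussianPDF _ _).mul (hh.mul (hW.comp measurable_prodMk_left))
        rw [← lintegral_const_mul _ hGx]
        refine lintegral_congr fun y => ?_
        ring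
    _ = _ := by
        have hJm : Measurable fun p : ℝ × ℝ => h p.2 * (ENNReal.ofReal (Real.exp (c * p.1 + d)) *
            (gaussianPDF (H * p.1) (outVar H a 0 p.1) p.2 * W (p.1, p.2))) :=
          (hh.comp measurable_snd).mul hLm
        rw [lintegral_lintegral_swap (f := fun x y => h y * (ENNReal.ofReal (Real.exp (c * x + d)) *
          (gaussianPDF (H * x) (outVar H a 0 x) y * W (x, y)))) hJm.aemeasurable]
        refine lintegral_congr fun y => ?_
        have hLy : Measurable fun x => ENNReal.ofReal (Real.exp (c * x + d)) *
            (gaussianPDF (H * x) (outVar H a 0 x) y * W (x, y)) :=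
          Measurable.mul (by fun_prop)
            ((measurable_transition_left H a 0 y).mul (hW.comp measurable_prodMk_right))
        rw [lintegral_const_mul _ hLy]

/-- After Tonelli, the integral over `x` is `k` times an occupation density, hence at most 1 for
each `y`. What remains is the total mass of the output density smeared by Gaussian noise. -/
lemma lintegral_likelihood_le {k m c d : ℝ} [IsProbabilityMeasure (expInput A c d)]
    (hH : 0 < H) (ha : a ≠ 0) (hb : b ≠ 0)
    (hm : 0 < m) (hk : 0 < k) (hk2 : k ^ 2 = H ^ 2 + 2 * H * a / m) :
    ∫⁻ p : ℝ × ℝ × ℝ, outDens H a b (expInput A c d)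
        (H * p.1 + Real.sqrt (H * p.1) * p.2.1 + p.2.2) *
        ENNReal.ofReal (Real.exp (-(p.1 / m) - (c * p.1 + d) + Real.log k -
          (H - k) / (H * a) * (H * p.1 + Real.sqrt (H * p.1) * p.2.1)))
      ∂(expInput A c d).prod ((gaussianReal 0 a).prod (gaussianReal 0 b)) ≤ 1 := by
  have ha' : (0 : ℝ) < a := by exact_mod_cast pos_iff_ne_zero.2 ha
  have hmo : Measurable (outDens H a b (expInput A c d)) := measurable_outDens
  have hmo2 : Measurable fun p : ℝ × ℝ => outDens H a b (expInput A c d) (p.1 + p.2) :=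
    hmo.comp (measurable_fst.add measurable_snd)
  have hWm : Measurable fun p : ℝ × ℝ => ENNReal.ofReal (Real.exp (-(p.1 / m) - (c * p.1 + d) +
      Real.log k - (H - k) / (H * a) * p.2)) := by fun_prop
  -- Translation invariance of Lebesgue measure: every shift of the output density has mass 1.
  have hh1 : ∫⁻ y, (∫⁻ z, outDens H a b (expInput A c d) (y + z) ∂gaussianReal 0 b) = 1 := by
    rw [lintegral_lintegral_swap hmo2.aemeasurable]
    simp_rw [lintegral_add_right_eq_self (outDens H a b (expInput A c d)), lintegral_outDens hb]
    simp
  have hk1 : ∀ y, ∫⁻ x in Set.Ioc 0 A, ENNReal.ofReal (Real.exp (c * x + d)) *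
      (gaussianPDF (H * x) (outVar H a 0 x) y * ENNReal.ofReal (Real.exp (-(x / m) -
        (c * x + d) + Real.log k - (H - k) / (H * a) * y))) ≤ 1 := fun y => by
    calc _ = ∫⁻ x in Set.Ioc 0 A, ENNReal.ofReal k * ENNReal.ofReal ((Real.sqrt (2 * Real.pi *
          (H * a * x)))⁻¹ * Real.exp (-(y - k * x) ^ 2 / (2 * (H * a * x)))) := by
          refine setLIntegral_congr_fun measurableSet_Ioc fun x hx => ?_
          rw [← ENNReal.ofReal_mul hk.le,
            ← tilted_transition_eq (c := c) (d := d) hH ha hm hk hk2 hx.1,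
            ENNReal.ofReal_mul (Real.exp_nonneg _),
            ENNReal.ofReal_mul (gaussianPDFReal_nonneg _ _ _), gaussianPDF]
      _ ≤ ENNReal.ofReal k * ENNReal.ofReal k⁻¹ := by
          rw [lintegral_const_mul _ (by fun_prop)]
          gcongr
          exact lintegral_drift_le hk (by positivity : 0 < H * a) y A
      _ = 1 := by rw [← ENNReal.ofReal_mul hk.le, mul_inv_cancel₀ hk.ne', ENNReal.ofReal_one]
  rw [lintegral_noise hmo hWm, lintegral_expInput_gaussianReal hH ha A c d
    hmo2.lintegral_prod_right' hWm]
  calc _ ≤ ∫⁻ y, (∫⁻ z, outDens H a b (expInput A c d) (y + z) ∂gaussianReal 0 b) * 1 := by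
        gcongr with y
        exact hk1 y
    _ = 1 := by simpa using hh1

/-- The output entropy exceeds the input entropy by an explicit amount. -/
lemma integral_log_outDens_le {k m c d : ℝ} [IsProbabilityMeasure (expInput A c d)]
    (hH : 0 < H) (hA : 0 ≤ A) (ha : a ≠ 0) (hb : b ≠ 0) (hm : 0 < m)
    (hmean : ∫ x, x ∂expInput A c d = m) (hk : 0 < k) (hk2 : k ^ 2 = H ^ 2 + 2 * H * a / m) :
    ∫ p, Real.log (outDens H a b (expInput A c d) p.2).toReal
      ∂channelLaw H a b (expInput A c d) ≤
    1 + (c * m + d) - Real.log k + (H - k) * m / a := by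
  have ha' : (0 : ℝ) < a := by exact_mod_cast pos_iff_ne_zero.2 ha
  set μ := expInput A c d with hμdef
  have hμ : ∀ᵐ x ∂μ, x ∈ Set.Icc 0 A := ae_mem_Icc_expInput A c d
  have hmo : Measurable (outDens H a b μ) := measurable_outDens
  set M := μ.prod ((gaussianReal 0 a).prod (gaussianReal 0 b)) with hM
  have hxi : Integrable (fun x : ℝ => x) μ := by
    refine (integrable_const A).mono' (by fun_prop) ?_
    filter_upwards [hμ] with x hx
    rw [Real.norm_eq_abs, abs_of_nonneg hx.1]; exact hx.2
  have hsi : Integrable (fun x : ℝ => Real.sqrt (H * x)) μ := by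
    refine (integrable_const (Real.sqrt (H * A))).mono' (by fun_prop) ?_
    filter_upwards [hμ] with x hx
    rw [Real.norm_eq_abs, abs_of_nonneg (Real.sqrt_nonneg _)]
    have := hx.2
    gcongr
  have hz : Integrable (fun q : ℝ × ℝ => q.1) ((gaussianReal 0 a).prod (gaussianReal 0 b)) :=
    ((memLp_id_gaussianReal 1).integrable le_rfl).comp_fst _
  have hz0 : ∫ q : ℝ × ℝ, q.1 ∂(gaussianReal 0 a).prod (gaussianReal 0 b) = 0 := by
    have := integral_fun_fst (μ := gaussianReal 0 a) (ν := gaussianReal 0 b) (fun z : ℝ => z)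
    rw [integral_id_gaussianReal] at this
    simpa using this
  have hx1 : Integrable (fun p : ℝ × ℝ × ℝ => p.1) M := hxi.comp_fst _
  have hx2 : ∫ p, p.1 ∂M = m := by
    have := integral_fun_fst (μ := μ) (ν := (gaussianReal 0 a).prod (gaussianReal 0 b))
      (fun z : ℝ => z)
    rw [hmean] at this
    simpa using this
  have hs1 : Integrable (fun p : ℝ × ℝ × ℝ => Real.sqrt (H * p.1) * p.2.1) M := hsi.mul_prod hz
  have hs2 : ∫ p, Real.sqrt (H * p.1) * p.2.1 ∂M = 0 := by
    have := integral_prod_mul (μ := μ) (ν := (gaussianReal 0 a).prod (gaussianReal 0 b))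
      (fun x => Real.sqrt (H * x)) (fun q : ℝ × ℝ => q.1)
    rw [hz0, mul_zero] at this
    exact this
  have hT := measurable_channelMap H
  have hlm : Measurable fun p : ℝ × ℝ => Real.log (outDens H a b μ p.2).toReal :=
    (hmo.comp measurable_snd).ennreal_toReal.log
  have hl1 : Integrable (fun p : ℝ × ℝ × ℝ => Real.log (outDens H a b μ
      (H * p.1 + Real.sqrt (H * p.1) * p.2.1 + p.2.2)).toReal) M :=
    (integrable_map_measure hlm.aestronglyMeasurable hT.aemeasurable).1
      (integrable_log_outDens hH hA hb hμ)
  have hl2 : ∫ p, Real.log (outDens H a b μ p.2).toReal ∂channelLaw H a b μ =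
      ∫ p, Real.log (outDens H a b μ
      (H * p.1 + Real.sqrt (H * p.1) * p.2.1 + p.2.2)).toReal ∂M := by
    rw [channelLaw, integral_map hT.aemeasurable hlm.aestronglyMeasurable]
  set E : ℝ × ℝ × ℝ → ℝ := fun p => -(p.1 / m) - (c * p.1 + d) + Real.log k -
          (H - k) / (H * a) * (H * p.1 + Real.sqrt (H * p.1) * p.2.1) with hE
  -- The exponent is affine in the input up to a multiple of the signal-dependent noise, which has
  -- mean zero, so its expectation depends on the input through `m` alone.
  have hE' : E = fun p => (-(1 / m) - c - (H - k) / (H * a) * H) * p.1 + (Real.log k - d) +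
      (-((H - k) / (H * a))) * (Real.sqrt (H * p.1) * p.2.1) := by
    ext p; rw [hE]; ring
  have hE1 : Integrable E M := by
    rw [hE']
    exact ((hx1.const_mul _).add (integrable_const _)).add (hs1.const_mul _)
  have hE2 : ∫ p, E p ∂M = -1 - (c * m + d) + Real.log k - (H - k) * m / a := by
    rw [hE', integral_add (by exact (hx1.const_mul _).add (integrable_const _)) (hs1.const_mul _),
      integral_add (hx1.const_mul _) (integrable_const _), integral_const_mul, integral_const_mul,
      hx2, hs2]
    simp only [integral_const, probReal_univ, one_smul]
    field_simp
    ring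
  have hlog : ∀ p : ℝ × ℝ × ℝ, Real.log ((outDens H a b μ
      (H * p.1 + Real.sqrt (H * p.1) * p.2.1 + p.2.2)).toReal * Real.exp (E p)) =
      Real.log (outDens H a b μ
        (H * p.1 + Real.sqrt (H * p.1) * p.2.1 + p.2.2)).toReal + E p := fun p => by
    rw [Real.log_mul (toReal_outDens_pos hb _).ne' (Real.exp_ne_zero _), Real.log_exp]
  have hEm : Measurable E := by fun_prop
  have h := integral_log_nonpos (ρ := M) (F := fun p => (outDens H a b μ
      (H * p.1 + Real.sqrt (H * p.1) * p.2.1 + p.2.2)).toReal * Real.exp (E p))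
    (.of_forall fun p => mul_pos (toReal_outDens_pos hb _) (Real.exp_pos _))
    (by
      have : Measurable fun p : ℝ × ℝ × ℝ => (outDens H a b μ
        (H * p.1 + Real.sqrt (H * p.1) * p.2.1 + p.2.2)).toReal :=
        ((hmo.comp measurable_snd).comp hT).ennreal_toReal
      exact (this.mul hEm.exp).aestronglyMeasurable)
    (by
      refine le_trans (le_of_eq ?_) (lintegral_likelihood_le (A := A) (c := c) (d := d) hH ha hb
        hm hk hk2)
      refine lintegral_congr fun p => ?_
      rw [ENNReal.ofReal_mul ENNReal.toReal_nonneg, ENNReal.ofReal_toReal (outDens_ne_top hb _)])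
    (by simp_rw [hlog]; exact hl1.add hE1)
  simp_rw [hlog] at h
  rw [integral_add hl1 hE1, ← hl2, hE2] at h
  linarith

end

/-! ### Existence and derivative of the exponential integral. -/

section

open Filter Topology

lemma continuousOn_exp_div {s : Set ℝ} (hs : ∀ t ∈ s, t ≠ 0) :
    ContinuousOn (fun t => Real.exp t / t) s :=
  ContinuousOn.div (by fun_prop) (by fun_prop) hs

lemma integrableOn_exp_div_Iic {x : ℝ} (hx : x < 0) :
    IntegrableOn (fun t => Real.exp t / t) (Set.Iic x) := by
  refine Integrable.mono' ((integrableOn_exp_Iic x).div_const |x|)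
    ((continuousOn_exp_div fun t ht => ?_).aestronglyMeasurable measurableSet_Iic) ?_
  · exact (lt_of_le_of_lt ht hx).ne
  · filter_upwards [ae_restrict_mem measurableSet_Iic] with t ht
    have ht' : t ≤ x := ht
    have h1 : |x| ≤ |t| := by
      rw [abs_of_neg hx, abs_of_neg (ht'.trans_lt hx)]; linarith
    have h2 : 0 < |x| := abs_pos.2 hx.ne
    rw [Real.norm_eq_abs, abs_div, Real.abs_exp]
    gcongr

lemma intervalIntegrable_exp_div_of_pos {x y : ℝ} (hx : 0 < x) (hy : 0 < y) :
    IntervalIntegrable (fun t => Real.exp t / t) volume x y :=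
  (continuousOn_exp_div fun _ ht => ((lt_min hx hy).trans_le ht.1).ne').intervalIntegrable

lemma intervalIntegrable_exp_div_of_neg {x y : ℝ} (hx : x < 0) (hy : y < 0) :
    IntervalIntegrable (fun t => Real.exp t / t) volume x y :=
  (continuousOn_exp_div fun _ ht => (ht.2.trans_lt (max_lt hx hy)).ne).intervalIntegrable

lemma Ei_of_neg {x : ℝ} (hx : x < 0) : Ei x = ∫ t in Set.Iic x, Real.exp t / t := by
  refine Tendsto.limUnder_eq (tendsto_const_nhds.congr' ?_)
  filter_upwards [Ioo_mem_nhdsGT (neg_pos.2 hx)] with ε hε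
  congr 2
  ext t
  simp only [Set.mem_Iic, Set.mem_sdiff, Set.mem_Ioo, not_and]
  exact ⟨fun h => ⟨h, fun h' => by linarith [hε.2]⟩, fun h => h.1⟩

/-- For positive arguments the principal value exists. -/
lemma exists_Ei_of_pos : ∃ K : ℝ, ∀ x, 0 < x → Ei x = K + ∫ t in (1 : ℝ)..x, Real.exp t / t := by
  set g : ℝ → ℝ := fun t => 2 * dslope Real.sinh 0 t with hg
  have hgc : Continuous g := by
    refine continuous_const.mul (continuousOn_univ.1 ?_)
    exact (continuousOn_dslope univ_mem).2
      ⟨Real.continuous_sinh.continuousOn, Real.differentiable_sinh 0⟩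
  have hgt : ∀ t, t ≠ 0 → g t = Real.exp t / t - Real.exp (-t) / t := fun t ht => by
    rw [hg]
    simp only
    rw [dslope_of_ne _ ht, slope_def_field, Real.sinh_zero, Real.sinh_eq]
    field_simp
    ring
  refine ⟨(∫ t in Set.Iic (-1), Real.exp t / t) + ∫ t in (0 : ℝ)..1, g t, fun x hx => ?_⟩
  refine Tendsto.limUnder_eq ?_
  have hlim : Tendsto (fun ε : ℝ => (∫ t in Set.Iic (-1), Real.exp t / t) +
      (∫ t in ε..1, g t) + ∫ t in (1 : ℝ)..x, Real.exp t / t) (𝓝[>] 0)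
      (𝓝 ((∫ t in Set.Iic (-1), Real.exp t / t) + (∫ t in (0 : ℝ)..1, g t) +
        ∫ t in (1 : ℝ)..x, Real.exp t / t)) := by
    have hc : Continuous fun ε : ℝ => ∫ t in ε..1, g t := by
      simp_rw [intervalIntegral.integral_symm 1]
      exact (intervalIntegral.continuous_primitive (fun a b => hgc.intervalIntegrable a b) 1).neg
    exact ((hc.tendsto 0).mono_left nhdsWithin_le_nhds).const_add _ |>.add_const _
  refine hlim.congr' ?_
  filter_upwards [Ioo_mem_nhdsGT (lt_min hx one_pos)] with ε hε
  have h0 : 0 < ε := hε.1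
  have hεx : ε < x := hε.2.trans_le (min_le_left _ _)
  have hε1 : ε < 1 := hε.2.trans_le (min_le_right _ _)
  have hset : Set.Iic x \ Set.Ioo (-ε) ε = Set.Iic (-ε) ∪ Set.Icc ε x := by
    ext t
    simp only [Set.mem_sdiff, Set.mem_Iic, Set.mem_Ioo, not_and, not_lt, Set.mem_union, Set.mem_Icc]
    constructor
    · rintro ⟨h1, h2⟩
      rcases le_or_gt t (-ε) with h | h
      · exact Or.inl h
      · exact Or.inr ⟨h2 h, h1⟩
    · rintro (h | h)
      · exact ⟨by linarith, fun h' => by linarith⟩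
      · exact ⟨h.2, fun _ => h.1⟩
  have hdisj : Disjoint (Set.Iic (-ε)) (Set.Icc ε x) := by
    rw [Set.disjoint_left]
    intro t ht ht'
    have : t ≤ -ε := ht
    linarith [ht'.1]
  have hneg : ∫ t in (-1 : ℝ)..(-ε), Real.exp t / t = -∫ t in ε..1, Real.exp (-t) / t := by
    rw [← intervalIntegral.integral_comp_neg, ← intervalIntegral.integral_neg]
    congr 1; ext t; rw [div_neg]
  have hi : IntervalIntegrable (fun t => Real.exp (-t) / t) volume ε 1 :=
    (ContinuousOn.div (by fun_prop) (by fun_prop)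
      fun t ht => ((lt_min h0 one_pos).trans_le ht.1).ne').intervalIntegrable
  have hgi : ∫ t in ε..1, g t = (∫ t in ε..1, Real.exp t / t) -
      ∫ t in ε..1, Real.exp (-t) / t := by
    rw [← intervalIntegral.integral_sub (intervalIntegrable_exp_div_of_pos h0 one_pos) hi]
    exact intervalIntegral.integral_congr fun t ht =>
      hgt t ((lt_min h0 one_pos).trans_le ht.1).ne'
  have hIic := intervalIntegral.integral_Iic_sub_Iic
    (integrableOn_exp_div_Iic (neg_lt_zero.2 one_pos)) (integrableOn_exp_div_Iic (neg_lt_zero.2 h0))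
  have hadd := intervalIntegral.integral_add_adjacent_intervals
    (intervalIntegrable_exp_div_of_pos h0 one_pos) (intervalIntegrable_exp_div_of_pos one_pos hx)
  rw [hset, setIntegral_union hdisj measurableSet_Icc
    (integrableOn_exp_div_Iic (neg_lt_zero.2 h0))
    ((continuousOn_exp_div fun t ht => (h0.trans_le ht.1).ne').integrableOn_Icc),
    integral_Icc_eq_integral_Ioc, ← intervalIntegral.integral_of_le hεx.le]
  linarith

lemma hasDerivAt_Ei {x : ℝ} (hx : x ≠ 0) : HasDerivAt Ei (Real.exp x / x) x := by
  have hmeas : ∀ s : Set ℝ, IsOpen s → (∀ t ∈ s, t ≠ 0) → x ∈ s →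
      StronglyMeasurableAtFilter (fun t => Real.exp t / t) (𝓝 x) volume := fun s hs h0 hxs =>
    (continuousOn_exp_div h0).stronglyMeasurableAtFilter hs x hxs
  have hcont : ContinuousAt (fun t => Real.exp t / t) x :=
    ContinuousAt.div (by fun_prop) (by fun_prop) hx
  rcases hx.lt_or_gt with h | h
  · have hd := (intervalIntegral.integral_hasDerivAt_right
      (intervalIntegrable_exp_div_of_neg (neg_lt_zero.2 one_pos) h)
      (hmeas (Set.Iio 0) isOpen_Iio (fun t ht => (show t < 0 from ht).ne) h) hcont).const_add
      (Ei (-1))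
    refine hd.congr_of_eventuallyEq ?_
    filter_upwards [Iio_mem_nhds h] with y hy
    have := intervalIntegral.integral_Iic_sub_Iic
      (integrableOn_exp_div_Iic (neg_lt_zero.2 one_pos)) (integrableOn_exp_div_Iic hy)
    rw [Ei_of_neg hy, Ei_of_neg (neg_lt_zero.2 one_pos), ← this]
    ring
  · obtain ⟨K, hK⟩ := exists_Ei_of_pos
    have hd := (intervalIntegral.integral_hasDerivAt_right
      (intervalIntegrable_exp_div_of_pos one_pos h)
      (hmeas (Set.Ioi 0) isOpen_Ioi (fun t ht => (show 0 < t from ht).ne') h) hcont).const_add K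
    refine hd.congr_of_eventuallyEq ?_
    filter_upwards [Ioi_mem_nhds h] with y hy using hK y hy

/-! ### Existence and uniqueness of the rate parameter. -/

/-- The mean, in units of the peak, of the truncated exponential law with rate `u`. -/
noncomputable def relMean (u : ℝ) : ℝ := 1 / (1 - Real.exp (-u)) - 1 / u

lemma one_sub_exp_neg_pos {u : ℝ} (hu : 0 < u) : 0 < 1 - Real.exp (-u) := by
  have := Real.exp_lt_one_iff.2 (neg_lt_zero.2 hu)
  linarith

lemma one_sub_exp_neg_ne_zero {u : ℝ} (hu : u ≠ 0) : 1 - Real.exp (-u) ≠ 0 := by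
  rw [sub_ne_zero, ne_comm, ne_eq, Real.exp_eq_one_iff]
  simpa using hu

lemma relMean_neg {u : ℝ} (hu : u ≠ 0) : relMean (-u) = 1 - relMean u := by
  have h1 := one_sub_exp_neg_ne_zero hu
  have h2 := one_sub_exp_neg_ne_zero (neg_ne_zero.2 hu)
  rw [relMean, relMean]
  rw [neg_neg] at h2 ⊢
  have h3 : Real.exp (-u) = (Real.exp u)⁻¹ := Real.exp_neg u
  rw [h3] at h1 ⊢
  have h4 := Real.exp_pos u
  have h5 : Real.exp u - 1 ≠ 0 := fun h => h2 (by linarith)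
  have h6 : 1 / (1 - (Real.exp u)⁻¹) = Real.exp u / (Real.exp u - 1) := by
    field_simp
  have h7 : 1 / (1 - Real.exp u) = -(1 / (Real.exp u - 1)) := by
    rw [← neg_sub, one_div_neg_eq_neg_one_div]
  rw [h6, h7]
  field_simp
  ring

lemma continuousOn_relMean : ContinuousOn relMean (Set.Ioi 0) := by
  refine ContinuousOn.sub (ContinuousOn.div (by fun_prop) (by fun_prop) fun u hu => ?_)
    (ContinuousOn.div (by fun_prop) (by fun_prop) fun u hu => ?_)
  · exact (one_sub_exp_neg_pos hu).ne'
  · exact (show 0 < u from hu).ne'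

/-- Since `1 - exp (-u) = 2 exp (-u/2) sinh (u/2)`, positivity of the derivative reduces to `u/2 <
sinh (u/2)`. -/
lemma strictMonoOn_relMean : StrictMonoOn relMean (Set.Ioi 0) := by
  refine strictMonoOn_of_deriv_pos (convex_Ioi 0) continuousOn_relMean fun u hu => ?_
  rw [interior_Ioi] at hu
  have hu' : 0 < u := hu
  have h1 := one_sub_exp_neg_pos hu'
  have hd1 : HasDerivAt (fun u => 1 - Real.exp (-u)) (Real.exp (-u)) u := by
    simpa using ((hasDerivAt_neg u).exp).const_sub 1
  have hd : HasDerivAt relMean (-Real.exp (-u) / (1 - Real.exp (-u)) ^ 2 - -1 / u ^ 2) u := by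
    have := (hd1.fun_inv h1.ne').sub ((hasDerivAt_id' u).fun_inv hu'.ne')
    refine this.congr_of_eventuallyEq (.of_forall fun v => ?_)
    simp [relMean, one_div]
  rw [hd.deriv]
  have hs : u / 2 < Real.sinh (u / 2) := Real.self_lt_sinh_iff.2 (by positivity)
  have he : 1 - Real.exp (-u) = 2 * Real.exp (-(u / 2)) * Real.sinh (u / 2) := by
    rw [Real.sinh_eq]
    have e1 : Real.exp (-(u / 2)) * Real.exp (u / 2) = 1 := by rw [← Real.exp_add]; simp
    have e2 : Real.exp (-(u / 2)) * Real.exp (-(u / 2)) = Real.exp (-u) := by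
      rw [← Real.exp_add]; congr 1; ring
    rw [← e2]; linear_combination -e1
  have he2 : Real.exp (-u) = Real.exp (-(u / 2)) ^ 2 := by
    rw [sq, ← Real.exp_add]; congr 1; ring
  have hlt : Real.exp (-u) * u ^ 2 < (1 - Real.exp (-u)) ^ 2 := by
    rw [he, he2, mul_pow, mul_pow]
    have : u ^ 2 < 2 ^ 2 * Real.sinh (u / 2) ^ 2 := by nlinarith
    have hp : 0 < Real.exp (-(u / 2)) ^ 2 := by positivity
    nlinarith
  have : Real.exp (-u) / (1 - Real.exp (-u)) ^ 2 < 1 / u ^ 2 := by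
    rw [div_lt_div_iff₀ (by positivity) (by positivity)]; linarith
  rw [neg_div, neg_div]
  linarith

lemma relMean_eq {u : ℝ} (hu : 0 < u) : relMean u = 1 + 1 / (Real.exp u - 1) - 1 / u := by
  have h1 : 1 < Real.exp u := Real.one_lt_exp_iff.2 hu
  have h2 : 1 - (Real.exp u)⁻¹ ≠ 0 := by
    have := one_sub_exp_neg_pos hu; rw [Real.exp_neg] at this; exact this.ne'
  have h3 : Real.exp u - 1 ≠ 0 := by linarith
  rw [relMean, Real.exp_neg]
  congr 1
  field_simp
  ring

lemma relMean_le {u : ℝ} (hu : 0 < u) : relMean u ≤ 1 - 1 / (2 + u) := by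
  have h1 := Real.quadratic_le_exp_of_nonneg hu.le
  have h2 : 1 / (Real.exp u - 1) ≤ 1 / (u + u ^ 2 / 2) :=
    one_div_le_one_div_of_le (by positivity) (by linarith)
  have h3 : 1 / (u + u ^ 2 / 2) - 1 / u = -(1 / (2 + u)) := by
    field_simp; ring
  rw [relMean_eq hu]; linarith

lemma le_relMean {u : ℝ} (hu : 0 < u) : 1 - 1 / u ≤ relMean u := by
  have h1 : 1 < Real.exp u := Real.one_lt_exp_iff.2 hu
  have : 0 < 1 / (Real.exp u - 1) := one_div_pos.2 (by linarith)
  rw [relMean_eq hu]; linarith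

/-- Clearing denominators leaves `(u - 2) exp u + u + 2 ≥ 0`. It is an equality at 0, and the left
side increases because `1 - x ≤ exp (-x)`. -/
lemma half_le_relMean {u : ℝ} (hu : 0 < u) : 1 / 2 ≤ relMean u := by
  have hd : ∀ x : ℝ, HasDerivAt (fun x => (x - 2) * Real.exp x + x)
      (1 * Real.exp x + (x - 2) * Real.exp x + 1) x := fun x =>
    (((hasDerivAt_id' x).sub_const 2).mul (Real.hasDerivAt_exp x)).add (hasDerivAt_id' x)
  have hm : MonotoneOn (fun x => (x - 2) * Real.exp x + x) (Set.Ici 0) := by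
    refine monotoneOn_of_deriv_nonneg (convex_Ici 0) (by fun_prop) (by fun_prop) fun x _ => ?_
    rw [(hd x).deriv]
    have h1 : -x + 1 ≤ Real.exp (-x) := Real.add_one_le_exp (-x)
    have h2 : Real.exp (-x) * Real.exp x = 1 := by rw [← Real.exp_add]; simp
    nlinarith [Real.exp_pos x]
  have h := hm (Set.mem_Ici.2 le_rfl) hu.le hu.le
  simp only [Real.exp_zero] at h
  have h1 : 0 < Real.exp u - 1 := by linarith [Real.one_lt_exp_iff.2 hu]
  rw [relMean_eq hu]
  have : 1 + 1 / (Real.exp u - 1) - 1 / u - 1 / 2 =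
      ((u - 2) * Real.exp u + u + 2) / (2 * u * (Real.exp u - 1)) := by
    field_simp; ring
  have h2 : 0 ≤ ((u - 2) * Real.exp u + u + 2) / (2 * u * (Real.exp u - 1)) :=
    div_nonneg (by linarith) (by positivity)
  linarith

/-- The bounds `1 - 1/u ≤ relMean u ≤ 1 - 1/(2 + u)`, each solved for the value `α`, give the
endpoints for the intermediate value theorem; `α > 1/2` keeps the left one positive. -/
lemma exists_relMean_eq {α : ℝ} (h1 : 1 / 2 < α) (h2 : α < 1) : ∃ u, 0 < u ∧ relMean u = α := by
  have hp : 0 < 1 - α := by linarith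
  have hinv : 2 < 1 / (1 - α) := by rw [lt_div_iff₀ hp]; linarith
  have hlo : 0 < 1 / (1 - α) - 2 := by linarith
  have hb1 : relMean (1 / (1 - α) - 2) ≤ α := by
    have := relMean_le hlo
    have e : 1 / (2 + (1 / (1 - α) - 2)) = 1 - α := by
      rw [add_sub_cancel, one_div_one_div]
    rw [e] at this; linarith
  have hb2 : α ≤ relMean (1 / (1 - α)) := by
    have := le_relMean (u := 1 / (1 - α)) (by linarith)
    rw [one_div_one_div] at this; linarith
  have hsub : Set.Icc (1 / (1 - α) - 2) (1 / (1 - α)) ⊆ Set.Ioi 0 := fun x hx =>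
    hlo.trans_le hx.1
  obtain ⟨u, hu, hu'⟩ := intermediate_value_Icc (by linarith : 1 / (1 - α) - 2 ≤ 1 / (1 - α))
    (continuousOn_relMean.mono hsub) ⟨hb1, hb2⟩
  exact ⟨u, hsub hu, hu'⟩

lemma existsUnique_relMean_eq_of_half_lt {α : ℝ} (h1 : 1 / 2 < α) (h2 : α < 1) :
    ∃! u, u ≠ 0 ∧ α = relMean u := by
  obtain ⟨u, hu, hu'⟩ := exists_relMean_eq h1 h2
  refine ⟨u, ⟨hu.ne', hu'.symm⟩, fun v ⟨hv0, hv⟩ => ?_⟩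
  rcases hv0.lt_or_gt with h | h
  · have h3 := half_le_relMean (neg_pos.2 h)
    rw [relMean_neg hv0] at h3
    linarith
  · exact strictMonoOn_relMean.injOn h hu (by rw [hu', hv])

/-- The reflection `u ↦ -u` exchanges `α` and `1 - α`, reducing to `α > 1/2`. -/
lemma existsUnique_relMean_eq {α : ℝ} (h0 : 0 < α) (h1 : α < 1) (h : α ≠ 1 / 2) :
    ∃! u, u ≠ 0 ∧ α = relMean u := by
  rcases h.lt_or_gt with h | h
  · obtain ⟨u, ⟨hu0, hu⟩, huniq⟩ :=
      existsUnique_relMean_eq_of_half_lt (α := 1 - α) (by linarith) (by linarith)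
    refine ⟨-u, ⟨neg_ne_zero.2 hu0, by rw [relMean_neg hu0]; linarith⟩, fun v ⟨hv0, hv⟩ => ?_⟩
    rw [← huniq (-v) ⟨neg_ne_zero.2 hv0, by rw [relMean_neg hv0, hv]⟩, neg_neg]
  · exact existsUnique_relMean_eq_of_half_lt h h1

lemma existsUnique_isRateParameter {α A : ℝ} (hA : 0 < A) (h0 : 0 < α) (h1 : α < 1)
    (h : α ≠ 1 / 2) : ∃! c, IsRateParameter α A c := by
  obtain ⟨u, ⟨hu0, hu⟩, huniq⟩ := existsUnique_relMean_eq h0 h1 h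
  refine ⟨u / A, ⟨div_ne_zero hu0 hA.ne', ?_⟩, fun v ⟨hv0, hv⟩ => ?_⟩
  · rw [div_mul_cancel₀ _ hA.ne']; exact hu
  · rw [← huniq (v * A) ⟨mul_ne_zero hv0 hA.ne', hv⟩, mul_div_cancel_right₀ _ hA.ne']

end

/-! ### Admissibility, moments, and the general lower bound on the capacity. -/

section

lemma jointLaw_eq_channelLaw (H ς σ : ℝ) (μ : Measure ℝ) :
    jointLaw H ς σ μ = channelLaw H (Real.toNNReal (ς ^ 2 * σ ^ 2)) (Real.toNNReal (σ ^ 2)) μ :=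
  rfl

lemma integral_expInput {A : ℝ} (hA : 0 ≤ A) (c d : ℝ) (g : ℝ → ℝ) :
    ∫ x, g x ∂expInput A c d = ∫ x in (0 : ℝ)..A, Real.exp (c * x + d) * g x := by
  rw [expInput, integral_withDensity_eq_integral_toReal_smul (by fun_prop) (by simp),
    intervalIntegral.integral_of_le hA]
  simp [ENNReal.toReal_ofReal (Real.exp_nonneg _)]

lemma isProbabilityMeasure_expInput {A : ℝ} (hA : 0 ≤ A) {c d : ℝ}
    (h : ∫ x in (0 : ℝ)..A, Real.exp (c * x + d) = 1) :
    IsProbabilityMeasure (expInput A c d) := by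
  refine ⟨?_⟩
  have hc : Continuous fun x => Real.exp (c * x + d) := by fun_prop
  rw [expInput, withDensity_apply _ MeasurableSet.univ, Measure.restrict_univ,
    ← ofReal_integral_eq_lintegral_ofReal, ← intervalIntegral.integral_of_le hA, h,
    ENNReal.ofReal_one]
  · exact ((hc.intervalIntegrable 0 A).1)
  · exact .of_forall fun x => (Real.exp_pos _).le

lemma isAdmissibleInput_expInput {A c d m : ℝ} [IsProbabilityMeasure (expInput A c d)]
    (hm : ∫ x, x ∂expInput A c d = m) : IsAdmissibleInput A m (expInput A c d) where
  isProbabilityMeasure := inferInstance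
  absolutelyContinuous :=
    (withDensity_absolutelyContinuous _ _).trans Measure.absolutelyContinuous_restrict
  mem_Icc := ae_mem_Icc_expInput A c d
  mean_eq := hm

section

variable {A m : ℝ} {μ : Measure ℝ} [IsProbabilityMeasure μ]

lemma integrable_of_continuousOn_Icc (hμ : ∀ᵐ x ∂μ, x ∈ Set.Icc 0 A) {g : ℝ → ℝ}
    (hm : Measurable g) (hg : ContinuousOn g (Set.Icc 0 A)) : Integrable g μ := by
  obtain ⟨C, hC⟩ := isCompact_Icc.exists_bound_of_continuousOn hg
  refine (integrable_const C).mono' hm.aestronglyMeasurable ?_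
  filter_upwards [hμ] with x hx using hC x hx

lemma integral_log_outVar {H ς σ : ℝ} (hH : 0 < H) (hσ : 0 < σ)
    (hμ : ∀ᵐ x ∂μ, x ∈ Set.Icc 0 A) :
    ∫ x, Real.log (2 * Real.pi * outVar H (Real.toNNReal (ς ^ 2 * σ ^ 2))
      (Real.toNNReal (σ ^ 2)) x) ∂μ =
    Real.log (2 * Real.pi * σ ^ 2) + ∫ x, Real.log (1 + H * ς ^ 2 * x) ∂μ := by
  have hpi := Real.pi_pos
  have hi : Integrable (fun x => Real.log (1 + H * ς ^ 2 * x)) μ := by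
    refine integrable_of_continuousOn_Icc hμ (Measurable.log (by fun_prop))
      (ContinuousOn.log (by fun_prop) fun x hx => ?_)
    have := hx.1
    positivity
  calc _ = ∫ x, (Real.log (2 * Real.pi * σ ^ 2) + Real.log (1 + H * ς ^ 2 * x)) ∂μ := by
        refine integral_congr_ae ?_
        filter_upwards [hμ] with x hx
        have hx0 := hx.1
        rw [outVar_coe_of_nonneg (by positivity), Real.coe_toNNReal _ (by positivity),
          Real.coe_toNNReal _ (by positivity), ← Real.log_mul (by positivity) (by positivity)]
        congr 1; ring
    _ = _ := by rw [integral_add (integrable_const _) hi]; simp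

lemma integral_outVar_add_sq {H ς σ : ℝ} (hH : 0 < H)
    (hμ : ∀ᵐ x ∂μ, x ∈ Set.Icc 0 A) (hm : ∫ x, x ∂μ = m) :
    ∫ x, (outVar H (Real.toNNReal (ς ^ 2 * σ ^ 2)) (Real.toNNReal (σ ^ 2)) x +
      (H * x - H * m) ^ 2) ∂μ =
    H ^ 2 * ((∫ x, x ^ 2 ∂μ) - m ^ 2) + H * m * ς ^ 2 * σ ^ 2 + σ ^ 2 := by
  have h1 : Integrable (fun x : ℝ => x) μ :=
    integrable_of_continuousOn_Icc hμ measurable_id continuousOn_id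
  have h2 : Integrable (fun x : ℝ => x ^ 2) μ :=
    integrable_of_continuousOn_Icc hμ (by fun_prop) (by fun_prop)
  calc _ = ∫ x, ((H ^ 2 * x ^ 2 + (H * ς ^ 2 * σ ^ 2 - 2 * H ^ 2 * m) * x) +
        (H ^ 2 * m ^ 2 + σ ^ 2)) ∂μ := by
        refine integral_congr_ae ?_
        filter_upwards [hμ] with x hx
        have hx0 := hx.1
        rw [outVar_coe_of_nonneg (by positivity), Real.coe_toNNReal _ (by positivity),
          Real.coe_toNNReal _ (by positivity)]
        ring
    _ = _ := by
        rw [integral_add (by exact (h2.const_mul _).add (h1.const_mul _)) (integrable_const _),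
          integral_add (h2.const_mul _) (h1.const_mul _), integral_const_mul, integral_const_mul,
          hm]
        simp
        ring

lemma sq_le_integral_sq (hμ : ∀ᵐ x ∂μ, x ∈ Set.Icc 0 A) (hm : ∫ x, x ∂μ = m) :
    m ^ 2 ≤ ∫ x, x ^ 2 ∂μ := by
  have h1 : Integrable (fun x : ℝ => x) μ :=
    integrable_of_continuousOn_Icc hμ measurable_id continuousOn_id
  have h2 : Integrable (fun x : ℝ => x ^ 2) μ :=
    integrable_of_continuousOn_Icc hμ (by fun_prop) (by fun_prop)
  have h3 : 0 ≤ ∫ x, (x ^ 2 - 2 * m * x + m ^ 2) ∂μ :=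
    integral_nonneg fun x => by
      have := sq_nonneg (x - m)
      simp only [Pi.zero_apply]; linarith
  rw [integral_add (by exact h2.sub (h1.const_mul _)) (integrable_const _),
    integral_sub h2 (h1.const_mul _), integral_const_mul, hm] at h3
  simp only [integral_const, probReal_univ, one_smul] at h3
  linarith

end

/-- The lower bound obtained from an input with a truncated exponential density. -/
lemma le_secrecyCapacity {HB ςB σB HE ςE σE A ξ P c d : ℝ}
    (hHB : 0 < HB) (hςB : 0 < ςB) (hσB : 0 < σB) (hHE : 0 < HE) (hςE : 0 < ςE) (hσE : 0 < σE)
    (hA : 0 < A) (hξ : 0 < ξ) (hP : 0 < P) [IsProbabilityMeasure (expInput A c d)]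
    (hmean : ∫ x, x ∂expInput A c d = ξ * P) :
    ((fLow HB ςB σB ξ P - (c * (ξ * P) + d) + 1 / 2 * (Real.log (σE ^ 2) - Real.log (σB ^ 2))
      + 1 / 2 * ((∫ x, Real.log (1 + HE * ςE ^ 2 * x) ∂expInput A c d)
        - ∫ x, Real.log (1 + HB * ςB ^ 2 * x) ∂expInput A c d)
      - 1 / 2 * Real.log (2 * Real.pi * Real.exp 1 *
        (HE ^ 2 * ((∫ x, x ^ 2 ∂expInput A c d) - (ξ * P) ^ 2)
          + HE * (ξ * P) * ςE ^ 2 * σE ^ 2 + σE ^ 2)) : ℝ) : EReal) ≤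
      secrecyCapacity HB ςB σB HE ςE σE A (ξ * P) := by
  have hpi := Real.pi_pos
  have hm : 0 < ξ * P := by positivity
  have hμ := ae_mem_Icc_expInput A c d
  refine le_trans ?_ (le_iSup₂_of_le (expInput A c d) (isAdmissibleInput_expInput hmean) le_rfl)
  have hne : ∀ {t : ℝ}, 0 < t → Real.toNNReal t ≠ 0 := fun h => by simpa using h
  have haB := hne (by positivity : 0 < ςB ^ 2 * σB ^ 2)
  have hbB := hne (by positivity : 0 < σB ^ 2)
  have hbE := hne (by positivity : 0 < σE ^ 2)
  rw [jointLaw_eq_channelLaw, jointLaw_eq_channelLaw, mutualInfo_channelLaw hHB hA.le hbB hμ,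
    mutualInfo_channelLaw hHE hA.le hbE hμ, ← EReal.coe_sub, EReal.coe_le_coe_iff,
    integral_log_outVar hHB hσB hμ, integral_log_outVar hHE hσE hμ]
  have hsq := sq_le_integral_sq hμ hmean
  have hV : 0 < HE ^ 2 * ((∫ x, x ^ 2 ∂expInput A c d) - (ξ * P) ^ 2)
      + HE * (ξ * P) * ςE ^ 2 * σE ^ 2 + σE ^ 2 := by
    have : 0 ≤ HE ^ 2 * ((∫ x, x ^ 2 ∂expInput A c d) - (ξ * P) ^ 2) :=
      mul_nonneg (by positivity) (by linarith)
    positivity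
  have hE := neg_integral_log_outDens_le hHE hA.le hbE hμ (HE * (ξ * P)) hV
    (integral_outVar_add_sq (ς := ςE) hHE hμ hmean)
  have hB := integral_log_outDens_le (k := Real.sqrt (HB ^ 2 + 2 * HB * ςB ^ 2 * σB ^ 2 / (ξ * P)))
    hHB hA.le haB hbB hm hmean (by positivity) (by
      rw [Real.sq_sqrt (by positivity), Real.coe_toNNReal _ (by positivity)]; ring)
  rw [Real.coe_toNNReal _ (by positivity), Real.log_sqrt (by positivity)] at hB
  -- The square root in `fLow` is the tilted drift `k` times the mean input.
  have hk : Real.sqrt (HB ^ 2 + 2 * HB * ςB ^ 2 * σB ^ 2 / (ξ * P)) * (ξ * P) =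
      Real.sqrt (HB * ξ * P * (HB * ξ * P + 2 * ςB ^ 2 * σB ^ 2)) := by
    rw [eq_comm, Real.sqrt_eq_iff_mul_self_eq (by positivity) (by positivity)]
    rw [mul_mul_mul_comm, Real.mul_self_sqrt (by positivity)]
    field_simp
  have hf : fLow HB ςB σB ξ P = 1 / 2 * Real.log (HB ^ 2 + 2 * HB * ςB ^ 2 * σB ^ 2 / (ξ * P)) -
      1 - (HB - Real.sqrt (HB ^ 2 + 2 * HB * ςB ^ 2 * σB ^ 2 / (ξ * P))) * (ξ * P) /
        (ςB ^ 2 * σB ^ 2) := by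
    rw [fLow, sub_mul, hk]
    field_simp
    ring
  have hl : Real.log (2 * Real.pi * Real.exp 1 *
        (HE ^ 2 * ((∫ x, x ^ 2 ∂expInput A c d) - (ξ * P) ^ 2)
          + HE * (ξ * P) * ςE ^ 2 * σE ^ 2 + σE ^ 2)) = 1 + Real.log (2 * Real.pi *
        (HE ^ 2 * ((∫ x, x ^ 2 ∂expInput A c d) - (ξ * P) ^ 2)
          + HE * (ξ * P) * ςE ^ 2 * σE ^ 2 + σE ^ 2)) := by
    rw [mul_right_comm, Real.log_mul (by positivity) (Real.exp_ne_zero _), Real.log_exp, add_comm]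
  rw [hf, hl, Real.log_mul (by positivity : 2 * Real.pi ≠ 0) (by positivity : σE ^ 2 ≠ 0),
    Real.log_mul (by positivity : 2 * Real.pi ≠ 0) (by positivity : σB ^ 2 ≠ 0)]
  linarith

/-! ### Closed forms of the integrals. -/

lemma integral_log_one_add_mul {A κ : ℝ} (hA : 0 < A) (hκ : 0 < κ) :
    ∫ x in (0 : ℝ)..A, Real.log (1 + κ * x) =
      A * Real.log (1 + κ * A) + Real.log (1 + κ * A) / κ - A := by
  have hpos : ∀ x ∈ Set.uIcc 0 A, 0 < 1 + κ * x := fun x hx => by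
    rw [Set.uIcc_of_le hA.le] at hx
    have := hx.1
    positivity
  rw [intervalIntegral.integral_eq_sub_of_hasDerivAt
    (f := fun x => (1 + κ * x) * Real.log (1 + κ * x) / κ - x) (fun x hx => ?_)
    (ContinuousOn.intervalIntegrable
      (ContinuousOn.log (by fun_prop) fun x hx => (hpos x hx).ne'))]
  · simp; field_simp; ring
  · have hx0 := hpos x hx
    have h1 : HasDerivAt (fun x => 1 + κ * x) κ x := by
      simpa using ((hasDerivAt_id x).const_mul κ).const_add 1
    refine (((h1.mul (h1.log hx0.ne')).div_const κ).sub (hasDerivAt_id' x)).congr_deriv ?_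
    field_simp
    ring

lemma integral_exp_mul_const {c : ℝ} (hc : c ≠ 0) (A : ℝ) :
    ∫ x in (0 : ℝ)..A, Real.exp (c * x) = (Real.exp (c * A) - 1) / c := by
  rw [intervalIntegral.integral_eq_sub_of_hasDerivAt (f := fun x => Real.exp (c * x) / c)
    (fun x _ => ?_) (Continuous.intervalIntegrable (by fun_prop) _ _)]
  · simp; ring
  · have h1 : HasDerivAt (fun x => c * x) c x := by simpa using (hasDerivAt_id x).const_mul c
    refine (h1.exp.div_const c).congr_deriv ?_
    field_simp

lemma integral_exp_mul_id {c : ℝ} (hc : c ≠ 0) (A : ℝ) :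
    ∫ x in (0 : ℝ)..A, Real.exp (c * x) * x =
      Real.exp (c * A) * (A / c - 1 / c ^ 2) + 1 / c ^ 2 := by
  rw [intervalIntegral.integral_eq_sub_of_hasDerivAt
    (f := fun x => Real.exp (c * x) * (x / c - 1 / c ^ 2))
    (fun x _ => ?_) (Continuous.intervalIntegrable (by fun_prop) _ _)]
  · simp
  · have h1 : HasDerivAt (fun x => c * x) c x := by simpa using (hasDerivAt_id x).const_mul c
    have h2 : HasDerivAt (fun x => x / c - 1 / c ^ 2) (1 / c) x :=
      ((hasDerivAt_id' x).div_const c).sub_const _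
    refine (h1.exp.mul h2).congr_deriv ?_
    field_simp
    ring

lemma integral_exp_mul_sq {c : ℝ} (hc : c ≠ 0) (A : ℝ) :
    ∫ x in (0 : ℝ)..A, Real.exp (c * x) * x ^ 2 =
      Real.exp (c * A) * (A ^ 2 / c - 2 * A / c ^ 2 + 2 / c ^ 3) - 2 / c ^ 3 := by
  rw [intervalIntegral.integral_eq_sub_of_hasDerivAt
    (f := fun x => Real.exp (c * x) * (x ^ 2 / c - 2 * x / c ^ 2 + 2 / c ^ 3))
    (fun x _ => ?_) (Continuous.intervalIntegrable (by fun_prop) _ _)]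
  · simp
  · have h1 : HasDerivAt (fun x => c * x) c x := by simpa using (hasDerivAt_id x).const_mul c
    have h2 : HasDerivAt (fun x => x ^ 2 / c - 2 * x / c ^ 2 + 2 / c ^ 3)
        (2 * x / c - 2 / c ^ 2) x := by
      have h3 := (((hasDerivAt_pow 2 x).div_const c).sub
        (((hasDerivAt_id' x).const_mul 2).div_const (c ^ 2))).add_const (2 / c ^ 3)
      refine h3.congr_deriv ?_
      simp
    refine (h1.exp.mul h2).congr_deriv ?_
    field_simp
    ring

/-- Integration by parts leaves the integral of `exp (c x) κ / (1 + κ x)`, and `t = (c/κ)(1 + κ x)`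
turns it into one of `exp t / t`. The range of `t` avoids 0, so only the derivative of `Ei` away
from 0 is used. -/
lemma integral_exp_mul_log {A κ c : ℝ} (hA : 0 < A) (hκ : 0 < κ) (hc : c ≠ 0) :
    ∫ x in (0 : ℝ)..A, Real.exp (c * x) * Real.log (1 + κ * x) =
      (Real.exp (c * A) * Real.log (1 + κ * A) -
        Real.exp (-(c / κ)) * (Ei (c / κ * (1 + κ * A)) - Ei (c / κ))) / c := by
  have hpos : ∀ x ∈ Set.uIcc 0 A, 0 < 1 + κ * x := fun x hx => by
    rw [Set.uIcc_of_le hA.le] at hx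
    have := hx.1
    positivity
  rw [intervalIntegral.integral_eq_sub_of_hasDerivAt
    (f := fun x => (Real.exp (c * x) * Real.log (1 + κ * x) -
      Real.exp (-(c / κ)) * Ei (c / κ * (1 + κ * x))) / c) (fun x hx => ?_)
    (ContinuousOn.intervalIntegrable (by
      exact ContinuousOn.mul (by fun_prop)
        (ContinuousOn.log (by fun_prop) fun x hx => (hpos x hx).ne')))]
  · simp; ring
  · have hx0 := hpos x hx
    have h0 : HasDerivAt (fun x => c * x) c x := by simpa using (hasDerivAt_id x).const_mul c
    have h1 : HasDerivAt (fun x => 1 + κ * x) κ x := by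
      simpa using ((hasDerivAt_id x).const_mul κ).const_add 1
    have hne : c / κ * (1 + κ * x) ≠ 0 := mul_ne_zero (div_ne_zero hc hκ.ne') hx0.ne'
    have h2 := (HasDerivAt.comp x (hasDerivAt_Ei hne) (h1.const_mul (c / κ))).const_mul
      (Real.exp (-(c / κ)))
    refine (((h0.exp.mul (h1.log hx0.ne')).sub h2).div_const c).congr_deriv ?_
    have he : Real.exp (c / κ * (1 + κ * x)) = Real.exp (c / κ) * Real.exp (c * x) := by
      rw [← Real.exp_add]; congr 1; field_simp
    have he2 : Real.exp (-(c / κ)) * Real.exp (c / κ) = 1 := by rw [← Real.exp_add]; simp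
    rw [he]
    have h3 : Real.exp (-(c / κ)) * (Real.exp (c / κ) * Real.exp (c * x) /
        (c / κ * (1 + κ * x)) * (c / κ * κ)) = Real.exp (c * x) * (κ / (1 + κ * x)) := by
      calc _ = (Real.exp (-(c / κ)) * Real.exp (c / κ)) * (Real.exp (c * x) /
        (c / κ * (1 + κ * x)) * (c / κ * κ)) := by ring
        _ = _ := by rw [he2]; field_simp
    rw [h3]
    field_simp
    ring

end

/-! ### The two explicit bounds. -/

lemma C₁_le_secrecyCapacity {HB ςB σB HE ςE σE A ξ P : ℝ}
    (hHB : 0 < HB) (hςB : 0 < ςB) (hσB : 0 < σB) (hHE : 0 < HE) (hςE : 0 < ςE) (hσE : 0 < σE)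
    (hA : 0 < A) (hξ : 0 < ξ) (hP : 0 < P) (h : ξ * P = A / 2) :
    ((C₁ HB ςB σB HE ςE σE A ξ P : ℝ) : EReal) ≤
      secrecyCapacity HB ςB σB HE ςE σE A (ξ * P) := by
  have hpi := Real.pi_pos
  -- Rate 0 and `d = -log A` give the uniform law.
  have hd : ∀ x : ℝ, Real.exp (0 * x + -Real.log A) = A⁻¹ := fun x => by
    rw [zero_mul, zero_add, Real.exp_neg, Real.exp_log hA]
  have hint : ∀ g : ℝ → ℝ, ∫ x, g x ∂expInput A 0 (-Real.log A) =
      A⁻¹ * ∫ x in (0 : ℝ)..A, g x := fun g => by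
    rw [integral_expInput hA.le]
    simp_rw [hd]
    rw [intervalIntegral.integral_const_mul]
  have : IsProbabilityMeasure (expInput A 0 (-Real.log A)) := by
    refine isProbabilityMeasure_expInput hA.le ?_
    simp_rw [hd]
    simp [hA.ne']
  have hmean : ∫ x, x ∂expInput A 0 (-Real.log A) = ξ * P := by
    rw [hint, integral_id, h]; field_simp; ring
  have hsq : ∫ x, x ^ 2 ∂expInput A 0 (-Real.log A) = A ^ 2 / 3 := by
    rw [hint, integral_pow]; field_simp; norm_num
  have hκB : 0 < HB * ςB ^ 2 := by positivity
  have hκE : 0 < HE * ςE ^ 2 := by positivity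
  refine le_of_eq_of_le ?_ (le_secrecyCapacity hHB hςB hσB hHE hςE hσE hA hξ hP hmean)
  rw [EReal.coe_eq_coe_iff, hint, hint, hsq, integral_log_one_add_mul hA hκB,
    integral_log_one_add_mul hA hκE, C₁, h]
  have hV : 2 * Real.pi * Real.exp 1 * (HE ^ 2 * (A ^ 2 / 3 - (A / 2) ^ 2)
      + HE * (A / 2) * ςE ^ 2 * σE ^ 2 + σE ^ 2) = Real.pi * Real.exp 1 *
      (HE ^ 2 * A ^ 2 + 6 * A * HE * ςE ^ 2 * σE ^ 2 + 12 * σE ^ 2) / 6 := by ring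
  have hlog : Real.log (6 * A ^ 2 * σE ^ 2 / (Real.pi * Real.exp 1 * σB ^ 2 *
      (HE ^ 2 * A ^ 2 + 6 * A * HE * ςE ^ 2 * σE ^ 2 + 12 * σE ^ 2))) =
      2 * Real.log A + (Real.log (σE ^ 2) - Real.log (σB ^ 2)) - Real.log (Real.pi * Real.exp 1 *
      (HE ^ 2 * A ^ 2 + 6 * A * HE * ςE ^ 2 * σE ^ 2 + 12 * σE ^ 2) / 6) := by
    rw [← Real.log_div (by positivity) (by positivity),
      show 2 * Real.log A = Real.log (A ^ 2) by rw [Real.log_pow]; norm_num,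
      ← Real.log_mul (by positivity) (by positivity),
      ← Real.log_div (by positivity) (by positivity)]
    congr 1
    field_simp
  have hlog2 : Real.log ((1 + HE * ςE ^ 2 * A) / (1 + HB * ςB ^ 2 * A)) =
      Real.log (1 + HE * ςE ^ 2 * A) - Real.log (1 + HB * ςB ^ 2 * A) :=
    Real.log_div (by positivity) (by positivity)
  rw [hV, hlog, hlog2]
  field_simp
  ring

lemma C₂_le_secrecyCapacity {HB ςB σB HE ςE σE A ξ P c : ℝ}
    (hHB : 0 < HB) (hςB : 0 < ςB) (hσB : 0 < σB) (hHE : 0 < HE) (hςE : 0 < ςE) (hσE : 0 < σE)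
    (hA : 0 < A) (hξ : 0 < ξ) (hP : 0 < P) (hc : IsRateParameter (ξ * P / A) A c) :
    ((C₂ HB ςB σB HE ςE σE A ξ P c : ℝ) : EReal) ≤
      secrecyCapacity HB ςB σB HE ςE σE A (ξ * P) := by
  obtain ⟨hc0, hc⟩ := hc
  have hcA : c * A ≠ 0 := mul_ne_zero hc0 hA.ne'
  have hE1 : Real.exp (c * A) - 1 ≠ 0 := by
    rw [sub_ne_zero, ne_eq, Real.exp_eq_one_iff]; exact hcA
  have hquot : 0 < c / (Real.exp (c * A) - 1) := by
    rcases hc0.lt_or_gt with h | h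
    · refine div_pos_of_neg_of_neg h ?_
      have := Real.exp_lt_one_iff.2 (mul_neg_of_neg_of_pos h hA)
      linarith
    · refine div_pos h ?_
      have := Real.one_lt_exp_iff.2 (mul_pos h hA)
      linarith
  have hinv : 1 / (1 - Real.exp (-(c * A))) = Real.exp (c * A) / (Real.exp (c * A) - 1) := by
    have h1 := one_sub_exp_neg_ne_zero hcA
    have h2 : Real.exp (-(c * A)) * Real.exp (c * A) = 1 := by rw [← Real.exp_add]; simp
    rw [div_eq_div_iff h1 hE1]
    linear_combination h2
  -- The normalising constant; its argument is positive for either sign of `c`.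
  set d := Real.log (c / (Real.exp (c * A) - 1)) with hd
  have hexp : ∀ x : ℝ, Real.exp (c * x + d) = c / (Real.exp (c * A) - 1) * Real.exp (c * x) :=
    fun x => by rw [Real.exp_add, hd, Real.exp_log hquot, mul_comm]
  have hint : ∀ g : ℝ → ℝ, ∫ x, g x ∂expInput A c d =
      c / (Real.exp (c * A) - 1) * ∫ x in (0 : ℝ)..A, Real.exp (c * x) * g x := fun g => by
    rw [integral_expInput hA.le]
    simp_rw [hexp, mul_assoc]
    rw [intervalIntegral.integral_const_mul]
  have : IsProbabilityMeasure (expInput A c d) := by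
    refine isProbabilityMeasure_expInput hA.le ?_
    simp_rw [hexp]
    rw [intervalIntegral.integral_const_mul, integral_exp_mul_const hc0]
    field_simp
  -- The equation defining `c` is exactly the mean constraint.
  have hmean : ∫ x, x ∂expInput A c d = ξ * P := by
    rw [hint, integral_exp_mul_id hc0]
    rw [hinv] at hc
    have h1 : ξ * P = A * (Real.exp (c * A) / (Real.exp (c * A) - 1) - 1 / (c * A)) := by
      rw [← hc]; field_simp
    rw [h1]
    field_simp
    ring
  have hsq : ∫ x, x ^ 2 ∂expInput A c d =
      A * (c * A - 2) / (c * (1 - Real.exp (-(c * A)))) + 2 / c ^ 2 := by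
    have h1 : A * (c * A - 2) / (c * (1 - Real.exp (-(c * A)))) =
        A * (c * A - 2) / c * (1 / (1 - Real.exp (-(c * A)))) := by
      rw [div_mul_div_comm, mul_one]
    rw [hint, integral_exp_mul_sq hc0, h1, hinv]
    field_simp
    ring
  have hκB : 0 < HB * ςB ^ 2 := by positivity
  have hκE : 0 < HE * ςE ^ 2 := by positivity
  refine le_of_eq_of_le ?_ (le_secrecyCapacity hHB hςB hσB hHE hςE hσE hA hξ hP hmean)
  rw [EReal.coe_eq_coe_iff, hint, hint, hsq, integral_exp_mul_log hA hκB hc0,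
    integral_exp_mul_log hA hκE hc0, C₂]
  have hlog1 : Real.log (σE ^ 2 / σB ^ 2 * ((Real.exp (c * A) - 1) ^ 2 / c ^ 2)) =
      Real.log (σE ^ 2) - Real.log (σB ^ 2) - 2 * d := by
    have h1 : Real.log ((Real.exp (c * A) - 1) ^ 2 / c ^ 2) = -2 * d := by
      rw [← div_pow, ← inv_div, Real.log_pow, Real.log_inv, hd]
      push_cast
      ring
    rw [Real.log_mul (by positivity) (by positivity), Real.log_div (by positivity) (by positivity),
      h1]
    ring
  have hlog2 : Real.log ((1 + HE * ςE ^ 2 * A) / (1 + HB * ςB ^ 2 * A)) =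
      Real.log (1 + HE * ςE ^ 2 * A) - Real.log (1 + HB * ςB ^ 2 * A) :=
    Real.log_div (by positivity) (by positivity)
  rw [hlog1, hlog2, mul_pow, ← mul_assoc HE ξ P]
  field_simp
  ring

end VLC

theorem theorem3 (HB ςB σB HE ςE σE A ξ P α : ℝ)
    (hHB : 0 < HB) (hςB : 0 < ςB) (hσB : 0 < σB)
    (hHE : 0 < HE) (hςE : 0 < ςE) (hσE : 0 < σE)
    (hA : 0 < A) (hξ : 0 < ξ) (hξ1 : ξ ≤ 1) (hP : 0 < P) (hPA : P ≤ A)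
    (hα : α = ξ * P / A) (hα1 : α < 1) :
    (α = 1 / 2 →
      ((VLC.C₁ HB ςB σB HE ςE σE A ξ P : ℝ) : EReal) ≤
        VLC.secrecyCapacity HB ςB σB HE ςE σE A (ξ * P)) ∧
    (α ≠ 1 / 2 →
      (∃! c : ℝ, VLC.IsRateParameter α A c) ∧
      ∀ c : ℝ, VLC.IsRateParameter α A c →
        ((VLC.C₂ HB ςB σB HE ςE σE A ξ P c : ℝ) : EReal) ≤
          VLC.secrecyCapacity HB ςB σB HE ςE σE A (ξ * P)) := by
  have hα0 : 0 < α := by rw [hα]; positivity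
  refine ⟨fun h => ?_, fun h => ⟨VLC.existsUnique_isRateParameter hA hα0 hα1 h, fun c hc => ?_⟩⟩
  · refine VLC.C₁_le_secrecyCapacity hHB hςB hσB hHE hςE hσE hA hξ hP ?_
    rw [hα, div_eq_iff hA.ne'] at h
    linarith
  · rw [hα] at hc
    exact VLC.C₂_le_secrecyCapacity hHB hςB hσB hHE hςE hσE hA hξ hP hc
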